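/- Let $\theta$ be an irrational number, and let $R$ be the hyperfinite type $\mathrm{II}_1$ factor (with its faithful normal tracial state $\tau$) generated as a von Neumann algebra by two unitary operators $u,v$ on a Hilbert space with $vu=e^{2\pi i\theta}uv$. Let $m$ be the normalized Haar measure on the unit circle $S^1$ and let $f\in L^\infty(S^1,m)$ be such that the operator $f(v)$ (defined by the spectral theorem) is not a scalar multiple of the identity. Let $N=W^*(u,f(v))$ be the von Neumann algebra generated by $u$ and $f(v)$. Then $N$ is an irreducible subfactor of $R$ (that is, $N\subseteq R$ is a $\mathrm{II}_1$ factor and $N'\cap R=\mathbb{C}1$), and its Jones index $[R:N]=\dim_N L^2(R,\tau)$ is a finite (positive) integer. Moreover, for every integer $n\ge 1$ the following conditions are equivalent: 1. $f$ is a periodic function with minimal period $e^{2\pi i/n}$, that is, $f(e^{2\pi i/n}z)=f(z)$ for almost all $z\in S^1$, and there is no $t$ with $0<t<1/n$ such that $f(e^{2\pi it}z)=f(z)$ for almost all $z\in S^1$ (for $n=1$ this means that $f$ has no period other than $1$); 2. $n$ is the greatest common divisor of $\{k\in\mathbb{Z}:\alpha_k\neq 0\}$, where $\alpha_k=\int_{S^1}f(z)z^{-k}\,dm(z)$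 are the Fourier coefficients of $f$; 3. $N=W^*(u,v^n)$. -/

import Mathlib

open MeasureTheory
open scoped ComplexOrder ENNReal

noncomputable section

/-! ### Von Neumann algebras as C⋆-algebras -/

section VonNeumann

variable {H : Type*} [NormedAddCommGroup H] [InnerProductSpace ℂ H] [CompleteSpace H]

instance vonNeumannSMulMemClass : SMulMemClass (VonNeumannAlgebra H) ℂ (H →L[ℂ] H) where
  smul_mem {s} c _ hx := s.toStarSubalgebra.smul_mem hx c

theorem vonNeumann_isClosed (M : VonNeumannAlgebra H) : IsClosed (M : Set (H →L[ℂ] H)) := by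
  rw [← M.centralizer_centralizer]
  exact Set.isClosed_centralizer _

/-- A von Neumann algebra is a C⋆-algebra (for the operator norm). -/
instance vonNeumannCStarAlgebra (M : VonNeumannAlgebra H) : CStarAlgebra M :=
  StarSubalgebra.cstarAlgebra M (h_closed := vonNeumann_isClosed M)

/-- The order of a von Neumann algebra `M` is the one inherited from the operators on `H`;
its positive elements are the `x* x` with `x ∈ M`. -/
instance vonNeumannStarOrderedRing (M : VonNeumannAlgebra H) : StarOrderedRing M := by
  refine StarOrderedRing.of_nonneg_iff' (fun {x y} hxy z => ?_) (fun x => ⟨fun hx => ?_, ?_⟩)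
  · exact Subtype.coe_le_coe.mp (add_le_add_right (Subtype.coe_le_coe.mpr hxy) _)
  · have hx' : (0 : H →L[ℂ] H) ≤ x := hx
    have hsa : IsSelfAdjoint (cfc Real.sqrt (x : H →L[ℂ] H)) := cfc_predicate _ _
    have hsq : cfc Real.sqrt (x : H →L[ℂ] H) * cfc Real.sqrt (x : H →L[ℂ] H) = x := by
      rw [← cfc_mul Real.sqrt Real.sqrt (x : H →L[ℂ] H)]
      conv_rhs => rw [← cfc_id ℝ (x : H →L[ℂ] H)]
      exact cfc_congr fun t ht => Real.mul_self_sqrt (spectrum_nonneg_of_nonneg hx' ht)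
    have hmem : cfc Real.sqrt (x : H →L[ℂ] H) ∈ M :=
      cfc_mem (𝕜' := ℂ) (hs := vonNeumann_isClosed M) Real.sqrt x.2
    exact ⟨⟨_, hmem⟩, Subtype.ext (by simpa [hsa.star_eq] using hsq.symm)⟩
  · rintro ⟨s, rfl⟩
    exact star_mul_self_nonneg (s : H →L[ℂ] H)

theorem star_coe_centralizer (S : Set (H →L[ℂ] H)) :
    star (StarSubalgebra.centralizer ℂ S : Set (H →L[ℂ] H)) =
      (StarSubalgebra.centralizer ℂ S : Set (H →L[ℂ] H)) :=
  Set.ext fun x => star_mem_iff (s := StarSubalgebra.centralizer ℂ S) (x := x)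

/-- `W*(S)`: the von Neumann algebra `(S ∪ S*)''` generated by a set `S` of operators. -/
def vonNeumannGenerated (S : Set (H →L[ℂ] H)) : VonNeumannAlgebra H where
  toStarSubalgebra := StarSubalgebra.centralizer ℂ (StarSubalgebra.centralizer ℂ S : Set (H →L[ℂ] H))
  centralizer_centralizer' := by
    have h := star_coe_centralizer S
    change Set.centralizer (Set.centralizer (StarSubalgebra.centralizer ℂ
      (StarSubalgebra.centralizer ℂ S : Set (H →L[ℂ] H)) : Set (H →L[ℂ] H))) =
      (StarSubalgebra.centralizer ℂ
        (StarSubalgebra.centralizer ℂ S : Set (H →L[ℂ] H)) : Set (H →L[ℂ] H))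
    rw [StarSubalgebra.coe_centralizer ℂ (StarSubalgebra.centralizer ℂ S : Set (H →L[ℂ] H)), h,
      Set.union_self, Set.centralizer_centralizer_centralizer]

/-- The carrier of `W*(S)` is the double commutant of `S ∪ S*`. -/
theorem coe_vonNeumannGenerated (S : Set (H →L[ℂ] H)) :
    (vonNeumannGenerated S : Set (H →L[ℂ] H)) = Set.centralizer (Set.centralizer (S ∪ star S)) := by
  have h := star_coe_centralizer S
  change (StarSubalgebra.centralizer ℂ
    (StarSubalgebra.centralizer ℂ S : Set (H →L[ℂ] H)) : Set (H →L[ℂ] H)) = _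
  rw [StarSubalgebra.coe_centralizer ℂ (StarSubalgebra.centralizer ℂ S : Set (H →L[ℂ] H)), h,
    Set.union_self, StarSubalgebra.coe_centralizer]

/-- A factor: the center consists of the scalar operators. -/
def IsFactor (M : VonNeumannAlgebra H) : Prop :=
  ∀ x ∈ M, (∀ y ∈ M, x * y = y * x) → ∃ c : ℂ, x = c • 1

/-- `τ` is a faithful normal tracial state on `M`. Normality is σ-weak continuity: `τ` is a
countable sum of vector functionals `x ↦ ⟪ξ i, x (ξ i)⟫` with `∑ i, ‖ξ i‖ ^ 2 < ∞`. -/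
structure IsFaithfulNormalTracialState {M : VonNeumannAlgebra H} (τ : M →ₚ[ℂ] ℂ) : Prop where
  map_one : τ 1 = 1
  tracial : ∀ x y : M, τ (x * y) = τ (y * x)
  faithful : ∀ x : M, τ (star x * x) = 0 → x = 0
  normal : ∃ ξ : ℕ → H, (Summable fun i => ‖ξ i‖ ^ 2) ∧
    ∀ x : M, HasSum (fun i => inner ℂ (ξ i) ((x : H →L[ℂ] H) (ξ i))) (τ x)

/-- A factor of type II₁: an infinite-dimensional factor with a faithful normal tracial state. -/
structure IsTypeII1Factor (M : VonNeumannAlgebra H) : Prop where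
  factor : IsFactor M
  infinite : ¬ FiniteDimensional ℂ M
  exists_trace : ∃ τ : M →ₚ[ℂ] ℂ, IsFaithfulNormalTracialState τ

/-- `N` is irreducible in `M`: the relative commutant `N' ∩ M` consists of the scalars. -/
def IsIrreducibleIn (N M : VonNeumannAlgebra H) : Prop :=
  ∀ x ∈ M, (∀ y ∈ N, x * y = y * x) → ∃ c : ℂ, x = c • 1

/-! ### The Jones index -/

/-- The inclusion of a von Neumann subalgebra, as a unital ⋆-homomorphism. -/
def vonNeumannInclusion {N M : VonNeumannAlgebra H} (h : N ≤ M) : N →⋆ₐ[ℂ] M where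
  toFun x := ⟨x, h x.2⟩
  map_one' := rfl
  map_mul' _ _ := rfl
  map_zero' := rfl
  map_add' _ _ := rfl
  commutes' _ := rfl
  map_star' _ := rfl

/-- The restriction of a positive functional to a von Neumann subalgebra. -/
def restrictFunctional {N M : VonNeumannAlgebra H} (h : N ≤ M) (τ : M →ₚ[ℂ] ℂ) : N →ₚ[ℂ] ℂ :=
  PositiveLinearMap.mk₀ (τ.toLinearMap ∘ₗ (vonNeumannInclusion h).toAlgHom.toLinearMap)
    fun x hx => τ.map_nonneg (show (0 : M) ≤ ⟨x, h x.2⟩ from hx)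

/-- The canonical cyclic vector `1` of the GNS space `L²(N, σ)`. -/
def gnsVector {N : VonNeumannAlgebra H} (σ : N →ₚ[ℂ] ℂ) : σ.GNS :=
  ((σ.toPreGNS 1 : σ.PreGNS) : σ.GNS)

/-- The Murray-von Neumann dimension `dim_N K` (the coupling constant) of a left module `K` over a
II₁ factor `N` with trace `σ`. It is the number `(σ' ⊗ Tr)(V V*) = ∑ i, ‖V* (δᵢ ⊗ 1)‖ ^ 2`, where
`V : K → ℓ²(ℕ) ⊗ L²(N, σ)` is an isometry commuting with the actions of `N`. This number is
the same for all such `V`; it is read as `∞` if there is no such `V`. -/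
def murrayVonNeumannDim {N : VonNeumannAlgebra H} (σ : N →ₚ[ℂ] ℂ)
    {K : Type*} [NormedAddCommGroup K] [InnerProductSpace ℂ K] [CompleteSpace K]
    (π : N →⋆ₐ[ℂ] (K →L[ℂ] K)) : ℝ≥0∞ :=
  ⨅ (V : K →ₗᵢ[ℂ] lp (fun _ : ℕ => σ.GNS) 2)
    (_ : ∀ (x : N) (ξ : K) (i : ℕ), V (π x ξ) i = σ.gnsStarAlgHom x (V ξ i)),
    ∑' i : ℕ, ‖V.toContinuousLinearMap.adjoint (lp.single 2 i (gnsVector σ))‖ₑ ^ 2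

/-- The Jones index `[M : N] = dim_N L²(M, τ)` of a subfactor `N` of a II₁ factor `M` with
trace `τ`. -/
def jonesIndex {N M : VonNeumannAlgebra H} (h : N ≤ M) (τ : M →ₚ[ℂ] ℂ) : ℝ≥0∞ :=
  murrayVonNeumannDim (restrictFunctional h τ) (τ.gnsStarAlgHom.comp (vonNeumannInclusion h))

end VonNeumann

/-! ### Functions on the unit circle -/

section CircleFunctions

instance circleMeasurableSpace : MeasurableSpace Circle := borel Circle

instance circleBorelSpace : BorelSpace Circle := ⟨rfl⟩

/-- The normalized Haar measure `m` of the unit circle. -/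
def circleMeasure : Measure Circle := Measure.haarMeasure ⊤

/-- The Fourier coefficient `α_k = ∫ f(z) z⁻ᵏ dm(z)`. -/
def circleFourierCoeff (f : Circle → ℂ) (k : ℤ) : ℂ :=
  ∫ z : Circle, f z * (z : ℂ) ^ (-k) ∂circleMeasure

/-- `ζ` is a period of `f`: `f(ζ z) = f(z)` for almost all `z`. -/
def IsCirclePeriod (f : Circle → ℂ) (ζ : Circle) : Prop :=
  ∀ᵐ z ∂circleMeasure, f (ζ * z) = f z

/-- `f` is periodic with minimal period `e^{2πi/n}`: it is a period, and no `e^{2πit}` with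
`0 < t < 1/n` is one. (For `n = 1` this says that `f` has no period other than `1`.) -/
def HasMinimalCirclePeriod (f : Circle → ℂ) (n : ℕ) : Prop :=
  IsCirclePeriod f (Circle.exp (2 * Real.pi / n)) ∧
    ∀ t : ℝ, 0 < t → t < 1 / n → ¬ IsCirclePeriod f (Circle.exp (2 * Real.pi * t))

/-- `n` is the greatest common divisor of a set of integers. -/
def IsGcdOfSet (S : Set ℤ) (n : ℕ) : Prop :=
  (∀ k ∈ S, (n : ℤ) ∣ k) ∧ ∀ d : ℤ, (∀ k ∈ S, d ∣ k) → d ∣ n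

variable {H : Type*} [NormedAddCommGroup H] [InnerProductSpace ℂ H] [CompleteSpace H]

/-- `μ` is the spectral measure `E ↦ ⟪ξ, 1_E(v) ξ⟫` of the unitary operator `v` at the vector `ξ`:
the finite Borel measure on the circle with moments `∫ zᵏ dμ = ⟪ξ, vᵏ ξ⟫`, `k ∈ ℤ`. -/
def IsSpectralMeasure (v : unitary (H →L[ℂ] H)) (ξ : H) (μ : Measure Circle) : Prop :=
  IsFiniteMeasure μ ∧
    ∀ k : ℤ, ∫ z : Circle, (z : ℂ) ^ k ∂μ = inner ℂ ξ (((v ^ k : unitary (H →L[ℂ] H)) : H →L[ℂ] H) ξ)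

/-- The spectral measure at a vector is unique. -/
theorem IsSpectralMeasure.unique {v : unitary (H →L[ℂ] H)} {ξ : H} {μ ν : Measure Circle}
    (hμ : IsSpectralMeasure v ξ μ) (hν : IsSpectralMeasure v ξ ν) : μ = ν := by
  have := hμ.1
  have := hν.1
  let z : BoundedContinuousFunction Circle ℂ :=
    BoundedContinuousFunction.mkOfCompact ⟨fun z : Circle => (z : ℂ), by fun_prop⟩
  have hz : ∀ g ∈ Submonoid.closure ({z} ∪ star {z}), ∃ k : ℤ, ∀ x : Circle, g x = (x : ℂ) ^ k := by
    intro g hg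
    induction hg using Submonoid.closure_induction with
    | mem g hg =>
      rcases hg with hg | hg
      · exact ⟨1, fun x => by rw [Set.mem_singleton_iff.mp hg, zpow_one]; rfl⟩
      · refine ⟨-1, fun x => ?_⟩
        rw [← star_star g, Set.mem_singleton_iff.mp hg]
        rw [zpow_neg_one, ← Circle.coe_inv, Circle.coe_inv_eq_conj]
        rfl
    | one => exact ⟨0, fun x => by simp⟩
    | mul g h _ _ hg hh =>
      obtain ⟨k, hk⟩ := hg
      obtain ⟨l, hl⟩ := hh
      exact ⟨k + l, fun x => by simp [hk, hl, zpow_add₀ (Circle.coe_ne_zero x)]⟩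
  refine ext_of_forall_mem_subalgebra_integral_eq_of_polish (𝕜 := ℂ)
    (A := StarAlgebra.adjoin ℂ {z}) ?_ fun g hg => ?_
  · intro x y hxy
    refine ⟨fun x => (x : ℂ), ⟨_, ⟨z, StarAlgebra.self_mem_adjoin_singleton ℂ z, rfl⟩, rfl⟩,
      fun h => hxy (Circle.ext h)⟩
  · have hg' : g ∈ Submodule.span ℂ
        (Submonoid.closure ({z} ∪ star {z}) : Set (BoundedContinuousFunction Circle ℂ)) := by
      rw [← StarAlgebra.adjoin_eq_span]
      exact hg
    clear hg
    induction hg' using Submodule.span_induction with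
    | mem g hg =>
      obtain ⟨k, hk⟩ := hz g hg
      simp only [hk]
      rw [hμ.2 k, hν.2 k]
    | zero => simp
    | add g h _ _ hg hh =>
      simp only [BoundedContinuousFunction.coe_add, Pi.add_apply]
      rw [integral_add (g.integrable μ) (h.integrable μ),
        integral_add (g.integrable ν) (h.integrable ν), hg, hh]
    | smul c g _ hg =>
      simp only [BoundedContinuousFunction.coe_smul]
      rw [integral_smul, integral_smul, hg]

/-- `T = f(v)` in the sense of the spectral theorem: `⟪ξ, T ξ⟫ = ∫ f dμ` for every vector `ξ`, where
`μ` is the spectral measure of `v` at `ξ`. -/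
def IsFunctionOfUnitary (v : unitary (H →L[ℂ] H)) (f : Circle → ℂ) (T : H →L[ℂ] H) : Prop :=
  ∀ ξ : H, ∃ μ : Measure Circle, IsSpectralMeasure v ξ μ ∧ Integrable f μ ∧
    ∫ z, f z ∂μ = inner ℂ ξ (T ξ)

/-- There is at most one operator `f(v)`. -/
theorem IsFunctionOfUnitary.unique {v : unitary (H →L[ℂ] H)} {f : Circle → ℂ} {S T : H →L[ℂ] H}
    (hS : IsFunctionOfUnitary v f S) (hT : IsFunctionOfUnitary v f T) : S = T := by
  refine ContinuousLinearMap.coe_injective ((ext_inner_map _ _).mp fun ξ => ?_)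
  obtain ⟨μ, hμ, -, h₁⟩ := hS ξ
  obtain ⟨ν, hν, -, h₂⟩ := hT ξ
  obtain rfl := hμ.unique hν
  have h := congrArg (starRingEnd ℂ) (h₁.symm.trans h₂)
  rw [inner_conj_symm, inner_conj_symm] at h
  exact h

open Classical in
/-- The operator `f(v)`. -/
def functionOfUnitary (v : unitary (H →L[ℂ] H)) (f : Circle → ℂ) : H →L[ℂ] H :=
  if h : ∃ T, IsFunctionOfUnitary v f T then h.choose else 0

end CircleFunctions

end

/-!
Write `L²(R)` for the GNS space of the trace and `x̂` for the vector of `x ∈ R`. The relation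
`v u = ζ u v`, `ζ = e^{2πiθ}`, makes every monomial `uᵃ vᵇ` an eigenvector of conjugation by `u`
and by `v`, and since `ζ` is not a root of unity the pair of eigenvalues determines `(a, b)`. Hence
the trace kills the nontrivial monomials, and by the density theorem for bicommutants they form an
orthonormal basis of `L²(R)` (`exists_monomial_hilbertBasis`). The trace being faithful and normal,
a von Neumann subalgebra is closed in `R` for the norm of `L²(R)` (`mem_of_mem_closure`), so that
membership in a subalgebra can be decided on Fourier expansions.

The operator `T = f(v)` lies in `W*(v)`, and its Fourier expansion is `∑ₖ αₖ vᵏ`, because the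
spectral distribution of `v` in the trace is the Haar measure (`trace_zpow_mul_function`). The
algebra `N = W*(u, T)` is normalized by `u` and `v`, so the projection of `L²(R)` onto the closure
of `N` is diagonal in the monomial basis; therefore `vᵏ ∈ N` as soon as `αₖ ≠ 0`
(`monomial_mem_of_inner_ne_zero`). With `d` the greatest common divisor of these `k` this gives
`N = W*(u, vᵈ)` (`vonNeumannGenerated_function_eq`), and `d > 0` because `T` is not a scalar.

An element of `R` commuting with `u` and `vᵈ` has only the constant term in its expansion, so `N` is
irreducible. The decomposition `L²(R) = ⨁_{r < d} L²(N) vʳ` gives an isometry of `N`-modules into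
`ℓ²(ℕ) ⊗ L²(N)`, and Parseval's identity for the monomial bases shows that every such isometry
computes the value `d` (`tsum_adjoint_single`); so the index is `d`. Consequently `W*(u, vⁿ)`
determines `n`. Finally the periods of `f` are the `d`-th roots of unity, as a bounded function is
determined by its Fourier coefficients (`hasMinimalCirclePeriod_iff`).
-/

noncomputable section

/-! ### Generated von Neumann algebras and density in the bicommutant -/

section Generated

variable {H : Type*} [NormedAddCommGroup H] [InnerProductSpace ℂ H] [CompleteSpace H]

theorem mem_vonNeumannGenerated_iff {S : Set (H →L[ℂ] H)} {x : H →L[ℂ] H} :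
    x ∈ vonNeumannGenerated S ↔
      ∀ y : H →L[ℂ] H, (∀ s ∈ S ∪ star S, s * y = y * s) → y * x = x * y := by
  rw [← SetLike.mem_coe, coe_vonNeumannGenerated]
  rfl

theorem subset_vonNeumannGenerated (S : Set (H →L[ℂ] H)) :
    S ⊆ (vonNeumannGenerated S : Set (H →L[ℂ] H)) := fun s hs =>
  mem_vonNeumannGenerated_iff.mpr fun _ hy => (hy s (Or.inl hs)).symm

theorem VonNeumannAlgebra.mem_of_forall_commutant {M : VonNeumannAlgebra H} {x : H →L[ℂ] H}
    (h : ∀ y : H →L[ℂ] H, (∀ m ∈ M, m * y = y * m) → y * x = x * y) : x ∈ M := by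
  rw [← SetLike.mem_coe, ← M.centralizer_centralizer]
  exact h

theorem vonNeumannGenerated_le {S : Set (H →L[ℂ] H)} {M : VonNeumannAlgebra H}
    (h : S ⊆ (M : Set (H →L[ℂ] H))) : vonNeumannGenerated S ≤ M := fun x hx =>
  VonNeumannAlgebra.mem_of_forall_commutant fun y hy =>
    mem_vonNeumannGenerated_iff.mp hx y fun s hs => by
      rcases hs with hs | hs
      · exact hy s (h hs)
      · exact hy s (by simpa using star_mem (h hs))

/-- If a unitary conjugates every generator into `W*(S)`, then it conjugates `W*(S)` into
itself. -/
theorem conj_mem_vonNeumannGenerated {S : Set (H →L[ℂ] H)} {w : H →L[ℂ] H}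
    (hw : w ∈ unitary (H →L[ℂ] H)) (h : ∀ s ∈ S, w * s * star w ∈ vonNeumannGenerated S)
    {x : H →L[ℂ] H} (hx : x ∈ vonNeumannGenerated S) :
    w * x * star w ∈ vonNeumannGenerated S := by
  have h1 : star w * w = 1 := hw.1
  have h2 : w * star w = 1 := hw.2
  refine mem_vonNeumannGenerated_iff.mpr fun y hy => ?_
  have key : ∀ s : H →L[ℂ] H, w * s * star w ∈ vonNeumannGenerated S →
      s * (star w * y * w) = (star w * y * w) * s := fun s hs => by
    have := mem_vonNeumannGenerated_iff.mp hs y hy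
    calc s * (star w * y * w) = star w * (w * s * star w * y) * w := by
          simp only [← mul_assoc]; rw [h1, one_mul]
      _ = star w * (y * (w * s * star w)) * w := by rw [this]
      _ = _ := by simp only [mul_assoc]; rw [h1, mul_one]
  have := mem_vonNeumannGenerated_iff.mp hx (star w * y * w) fun s hs => by
    rcases hs with hs | hs
    · exact key s (h s hs)
    · refine key s ?_
      have := star_mem (h _ hs)
      simpa [mul_assoc] using this
  calc y * (w * x * star w) = w * (star w * y * w * x) * star w := by
        simp only [← mul_assoc]; rw [h2, one_mul]
    _ = w * (x * (star w * y * w)) * star w := by rw [this]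
    _ = _ := by simp only [mul_assoc]; rw [h2, mul_one]

theorem Submodule.commute_starProjection {K : Submodule ℂ H} [K.HasOrthogonalProjection]
    {T : H →L[ℂ] H} (h : ∀ x ∈ K, T x ∈ K) (h' : ∀ x ∈ K, star T x ∈ K) (x : H) :
    K.starProjection (T x) = T (K.starProjection x) := by
  refine Submodule.eq_starProjection_of_mem_orthogonal (h _ (K.starProjection_apply_mem x)) ?_
  rw [← map_sub, Submodule.mem_orthogonal]
  intro y hy
  rw [← ContinuousLinearMap.adjoint_inner_left]
  exact (Submodule.mem_orthogonal _ _).mp (K.sub_starProjection_mem_orthogonal x) _ (h' y hy)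

end Generated

section Density

theorem memℓp_two_iff_summable {ι : Type*} {E : ι → Type*} [∀ i, NormedAddCommGroup (E i)]
    {f : ∀ i, E i} : Memℓp f 2 ↔ Summable fun i => ‖f i‖ ^ 2 := by
  rw [memℓp_gen_iff (by norm_num)]
  norm_num

theorem lp.hasSum_norm_sq {ι : Type*} {E : ι → Type*} [∀ i, NormedAddCommGroup (E i)]
    (f : lp E 2) : HasSum (fun i => ‖f i‖ ^ 2) (‖f‖ ^ 2) := by
  have := lp.hasSum_norm (p := 2) (by norm_num) f
  norm_num at this
  exact this

section Amplification

variable {H : Type*} [NormedAddCommGroup H] [InnerProductSpace ℂ H]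

/-- The operator `1 ⊗ x` on `ℓ²(ℕ, H)`, acting by `x` on every coordinate. -/
def amplification (x : H →L[ℂ] H) : lp (fun _ : ℕ => H) 2 →L[ℂ] lp (fun _ : ℕ => H) 2 :=
  LinearMap.mkContinuous
    { toFun := fun ξ => ⟨fun i => x (ξ i), memℓp_two_iff_summable.mpr <|
        Summable.of_nonneg_of_le (fun _ => by positivity)
          (fun i => by
            rw [← mul_pow]
            exact pow_le_pow_left₀ (norm_nonneg _) (x.le_opNorm (ξ i)) 2)
          ((lp.hasSum_norm_sq ξ).summable.mul_left (‖x‖ ^ 2))⟩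
      map_add' := fun ξ η => by ext i; exact map_add x _ _
      map_smul' := fun c ξ => by ext i; exact map_smul x _ _ } ‖x‖ fun ξ => by
    rw [← sq_le_sq₀ (norm_nonneg _) (by positivity), mul_pow]
    refine hasSum_le (fun i => ?_) (lp.hasSum_norm_sq _)
      ((lp.hasSum_norm_sq ξ).mul_left (‖x‖ ^ 2))
    rw [← mul_pow]
    exact pow_le_pow_left₀ (norm_nonneg _) (x.le_opNorm (ξ i)) 2

@[simp]
theorem amplification_apply (x : H →L[ℂ] H) (ξ : lp (fun _ : ℕ => H) 2) (i : ℕ) :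
    amplification x ξ i = x (ξ i) := rfl

end Amplification

variable {H : Type*} [NormedAddCommGroup H] [InnerProductSpace ℂ H] [CompleteSpace H]

theorem star_amplification (x : H →L[ℂ] H) : star (amplification x) = amplification (star x) := by
  symm
  refine (ContinuousLinearMap.eq_adjoint_iff _ _).mpr fun ξ η => ?_
  rw [lp.inner_eq_tsum, lp.inner_eq_tsum]
  refine tsum_congr fun i => ?_
  simp only [amplification_apply]
  exact ContinuousLinearMap.adjoint_inner_left _ _ _

/-- An operator commuting with all `1 ⊗ s` has matrix entries in the commutant, hence commutes
with `1 ⊗ x` for `x` in the bicommutant. -/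
theorem commute_amplification {S : Set (H →L[ℂ] H)} {x : H →L[ℂ] H}
    (hx : x ∈ vonNeumannGenerated S)
    {P : lp (fun _ : ℕ => H) 2 →L[ℂ] lp (fun _ : ℕ => H) 2}
    (hP : ∀ s ∈ S ∪ star S, ∀ ξ, P (amplification s ξ) = amplification s (P ξ))
    (ξ : lp (fun _ : ℕ => H) 2) : P (amplification x ξ) = amplification x (P ξ) := by
  have hsingle : ∀ (y : H →L[ℂ] H) (j : ℕ) (h : H), amplification y (lp.single 2 j h) =
      lp.single 2 j (y h) := fun y j h => by
    ext i
    rw [amplification_apply]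
    rcases eq_or_ne i j with rfl | hij
    · rw [lp.single_apply_self, lp.single_apply_self]
    · rw [lp.single_apply_ne _ _ _ hij, lp.single_apply_ne _ _ _ hij, map_zero]
  suffices h : P ∘L amplification x = amplification x ∘L P from DFunLike.congr_fun h ξ
  refine lp.ext_continuousLinearMap (by norm_num) fun j => ?_
  ext h i
  simp only [ContinuousLinearMap.comp_apply, lp.singleContinuousLinearMap_apply, hsingle,
    amplification_apply]
  let Pij : H →L[ℂ] H :=
    lp.evalCLM ℂ (fun _ : ℕ => H) 2 i ∘L P ∘L lp.singleContinuousLinearMap ℂ (fun _ : ℕ => H) 2 j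
  have key := mem_vonNeumannGenerated_iff.mp hx Pij fun s hs => by
    ext h
    change s (P (lp.single 2 j h) i) = P (lp.single 2 j (s h)) i
    rw [← hsingle, hP s hs, amplification_apply]
  exact DFunLike.congr_fun key h

/-- The density theorem for bicommutants, in the form used here: if a subspace `E` of operators
contains `1` and is stable under left multiplication by `S ∪ S*`, then at any vector of
`ℓ²(ℕ, H)` the elements of `W*(S)` are approximated by those of `E`. -/
theorem amplification_mem_closure {S : Set (H →L[ℂ] H)} {E : Submodule ℂ (H →L[ℂ] H)}
    (h1 : 1 ∈ E) (hE : ∀ s ∈ S ∪ star S, ∀ e ∈ E, s * e ∈ E)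
    {x : H →L[ℂ] H} (hx : x ∈ vonNeumannGenerated S) (Ω : lp (fun _ : ℕ => H) 2) :
    amplification x Ω ∈ closure ((fun e => amplification e Ω) '' (E : Set (H →L[ℂ] H))) := by
  let ev : (H →L[ℂ] H) →ₗ[ℂ] lp (fun _ : ℕ => H) 2 :=
    { toFun := fun e => amplification e Ω
      map_add' := fun a b => by ext i; rfl
      map_smul' := fun c a => by ext i; rfl }
  let K : Submodule ℂ (lp (fun _ : ℕ => H) 2) := (E.map ev).topologicalClosure
  have : CompleteSpace K := (E.map ev).isClosed_topologicalClosure.completeSpace_coe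
  have hK : ∀ s ∈ S ∪ star S, ∀ ξ ∈ K, amplification s ξ ∈ K := fun s hs ξ hξ => by
    refine map_mem_closure (amplification s).continuous hξ fun η hη => ?_
    obtain ⟨e, he, rfl⟩ := hη
    exact ⟨s * e, hE s hs e he, by ext i; rfl⟩
  have hΩ : Ω ∈ K := subset_closure ⟨1, h1, by ext i; rfl⟩
  have hfin : K.starProjection (amplification x Ω) = amplification x (K.starProjection Ω) :=
    commute_amplification hx (fun s hs ξ => Submodule.commute_starProjection (hK s hs) (by
      rw [star_amplification]
      refine hK _ ?_
      rcases hs with hs | hs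
      · exact Or.inr (by simpa using hs)
      · exact Or.inl hs) ξ) Ω
  rw [Submodule.starProjection_eq_self_iff.mpr hΩ, Submodule.starProjection_eq_self_iff] at hfin
  exact hfin

end Density

/-! ### The space `L²(M, τ)` and closedness of subalgebras -/

section TraceSpace

open Filter Topology

variable {H : Type*} [NormedAddCommGroup H] [InnerProductSpace ℂ H] [CompleteSpace H]
  {M : VonNeumannAlgebra H} (τ : M →ₚ[ℂ] ℂ)

/-- The vector `x̂` of the GNS space `L²(M, τ)` given by an element `x` of `M`. -/
def gnsEmbedding : M →ₗ[ℂ] τ.GNS where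
  toFun x := ((τ.toPreGNS x : τ.PreGNS) : τ.GNS)
  map_add' x y := by rw [map_add, UniformSpace.Completion.coe_add]
  map_smul' c x := by rw [map_smul, UniformSpace.Completion.coe_smul]; rfl

theorem gnsVector_eq : gnsVector τ = gnsEmbedding τ 1 := rfl

theorem inner_gnsEmbedding (x y : M) :
    inner ℂ (gnsEmbedding τ x) (gnsEmbedding τ y) = τ (star x * y) :=
  UniformSpace.Completion.inner_coe (𝕜 := ℂ) (E := τ.PreGNS) (τ.toPreGNS x) (τ.toPreGNS y)

theorem denseRange_gnsEmbedding : DenseRange (gnsEmbedding τ) :=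
  UniformSpace.Completion.denseRange_coe (α := τ.PreGNS)

theorem gnsStarAlgHom_gnsEmbedding (a x : M) :
    τ.gnsStarAlgHom a (gnsEmbedding τ x) = gnsEmbedding τ (a * x) :=
  τ.gnsNonUnitalStarAlgHom_apply_coe

theorem norm_sq_gnsEmbedding (x : M) : ((‖gnsEmbedding τ x‖ ^ 2 : ℝ) : ℂ) = τ (star x * x) := by
  rw [← inner_gnsEmbedding, inner_self_eq_norm_sq_to_K]
  norm_cast

variable {τ}

namespace IsFaithfulNormalTracialState

theorem gnsEmbedding_injective (hτ : IsFaithfulNormalTracialState τ) :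
    Function.Injective (gnsEmbedding τ) := by
  rw [injective_iff_map_eq_zero]
  intro x hx
  refine hτ.faithful x ?_
  rw [← norm_sq_gnsEmbedding, hx]
  simp

theorem norm_gnsEmbedding_star (hτ : IsFaithfulNormalTracialState τ) (x : M) :
    ‖gnsEmbedding τ (star x)‖ = ‖gnsEmbedding τ x‖ := by
  rw [← sq_eq_sq₀ (norm_nonneg _) (norm_nonneg _), ← Complex.ofReal_inj, norm_sq_gnsEmbedding,
    norm_sq_gnsEmbedding, star_star, hτ.tracial]

theorem hasSum_norm_sq (_ : IsFaithfulNormalTracialState τ) {ξ : ℕ → H}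
    (hξ : ∀ x : M, HasSum (fun i => inner ℂ (ξ i) ((x : H →L[ℂ] H) (ξ i))) (τ x)) (x : M) :
    HasSum (fun i => ‖(x : H →L[ℂ] H) (ξ i)‖ ^ 2) (‖gnsEmbedding τ x‖ ^ 2) := by
  rw [← Complex.hasSum_ofReal, norm_sq_gnsEmbedding]
  convert hξ (star x * x) using 2 with i
  have : (((star x * x : M) : H →L[ℂ] H)) (ξ i) =
    ContinuousLinearMap.adjoint (x : H →L[ℂ] H) ((x : H →L[ℂ] H) (ξ i)) := rfl
  rw [this, ContinuousLinearMap.adjoint_inner_right, inner_self_eq_norm_sq_to_K]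
  norm_cast

theorem norm_apply_le (hτ : IsFaithfulNormalTracialState τ) {ξ : ℕ → H}
    (hξ : ∀ x : M, HasSum (fun i => inner ℂ (ξ i) ((x : H →L[ℂ] H) (ξ i))) (τ x)) (x : M) (i : ℕ) :
    ‖(x : H →L[ℂ] H) (ξ i)‖ ≤ ‖gnsEmbedding τ x‖ := by
  rw [← sq_le_sq₀ (norm_nonneg _) (norm_nonneg _)]
  exact le_hasSum (hτ.hasSum_norm_sq hξ x) i fun j _ => by positivity

/-- The vectors implementing a faithful trace are jointly cyclic for the commutant, as they are
jointly separating for `M`. -/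
theorem commutant_cyclic (hτ : IsFaithfulNormalTracialState τ) {ξ : ℕ → H}
    (hξ : ∀ x : M, HasSum (fun i => inner ℂ (ξ i) ((x : H →L[ℂ] H) (ξ i))) (τ x)) :
    (Submodule.span ℂ {η : H | ∃ y ∈ M.commutant, ∃ i, y (ξ i) = η}).topologicalClosure = ⊤ := by
  set D := Submodule.span ℂ {η : H | ∃ y ∈ M.commutant, ∃ i, y (ξ i) = η} with hD
  let K := D.topologicalClosure
  have : CompleteSpace K := D.isClosed_topologicalClosure.completeSpace_coe
  have hK : ∀ y ∈ M.commutant, ∀ η ∈ K, y η ∈ K := fun y hy η hη => by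
    refine map_mem_closure y.continuous hη fun η hη => ?_
    induction hη using Submodule.span_induction with
    | mem η hη =>
      obtain ⟨z, hz, i, rfl⟩ := hη
      exact Submodule.subset_span ⟨y * z, mul_mem hy hz, i, rfl⟩
    | zero => simp
    | add a b _ _ ha hb => rw [map_add]; exact add_mem ha hb
    | smul c a _ ha => rw [map_smul]; exact Submodule.smul_mem _ _ ha
  have hp : K.starProjection ∈ M := VonNeumannAlgebra.mem_of_forall_commutant fun y hy => by
    have hy' : y ∈ M.commutant := VonNeumannAlgebra.mem_commutant_iff.mpr hy
    ext η
    exact (Submodule.commute_starProjection (hK y hy') (hK _ (star_mem hy')) η).symm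
  have hfix : ∀ i, K.starProjection (ξ i) = ξ i := fun i =>
    Submodule.starProjection_eq_self_iff.mpr (subset_closure
      (Submodule.subset_span ⟨1, one_mem _, i, rfl⟩))
  have h0 : (1 - ⟨_, hp⟩ : M) = 0 := by
    apply hτ.gnsEmbedding_injective
    have := hτ.hasSum_norm_sq hξ (1 - ⟨_, hp⟩ : M)
    have h2 : (fun i => ‖((1 - ⟨_, hp⟩ : M) : H →L[ℂ] H) (ξ i)‖ ^ 2) = fun _ => 0 := by
      funext i
      have : ((1 - ⟨_, hp⟩ : M) : H →L[ℂ] H) (ξ i) = ξ i - K.starProjection (ξ i) := rfl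
      rw [this, hfix]; simp
    rw [h2] at this
    have := this.unique hasSum_zero
    simpa using this
  rw [eq_top_iff]
  intro η _
  rw [← Submodule.starProjection_eq_self_iff (K := K)]
  have := congrArg (fun x : M => (x : H →L[ℂ] H) η) h0
  exact (sub_eq_zero.mp this).symm

/-- A von Neumann subalgebra is closed in `M` for the norm of `L²(M, τ)`. -/
theorem mem_of_mem_closure (hτ : IsFaithfulNormalTracialState τ) {N : VonNeumannAlgebra H}
    {x : M} (hx : gnsEmbedding τ x ∈
      closure (gnsEmbedding τ '' {y : M | (y : H →L[ℂ] H) ∈ N})) : (x : H →L[ℂ] H) ∈ N := by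
  obtain ⟨ξ, -, hξ⟩ := hτ.normal
  obtain ⟨s, hs, hlim⟩ := mem_closure_iff_seq_limit.mp hx
  choose y hyN hy using hs
  have hlim' : Tendsto (fun n => ‖gnsEmbedding τ (y n - x)‖) atTop (𝓝 0) := by
    simpa [hy] using (tendsto_iff_norm_sub_tendsto_zero.mp hlim)
  have h1 : ∀ i, Tendsto (fun n => (y n : H →L[ℂ] H) (ξ i)) atTop (𝓝 ((x : H →L[ℂ] H) (ξ i))) :=
    fun i => by
      rw [tendsto_iff_norm_sub_tendsto_zero]
      exact squeeze_zero (fun _ => norm_nonneg _) (fun n => hτ.norm_apply_le hξ (y n - x) i) hlim'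
  have h2 : ∀ i, Tendsto (fun n => star (y n : H →L[ℂ] H) (ξ i)) atTop
      (𝓝 (star (x : H →L[ℂ] H) (ξ i))) := fun i => by
    rw [tendsto_iff_norm_sub_tendsto_zero]
    refine squeeze_zero (fun _ => norm_nonneg _) (fun n => ?_) hlim'
    have := hτ.norm_apply_le hξ (star (y n - x)) i
    rw [hτ.norm_gnsEmbedding_star] at this
    refine le_trans (le_of_eq ?_) this
    rw [star_sub]
    rfl
  refine VonNeumannAlgebra.mem_of_forall_commutant fun w hw => ?_
  -- It suffices to compare matrix coefficients on the dense span of the `z ξᵢ` with `z ∈ M'`.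
  have key : ∀ η ∈ Submodule.span ℂ {η : H | ∃ z ∈ M.commutant, ∃ i, z (ξ i) = η},
      ∀ ζ ∈ Submodule.span ℂ {η : H | ∃ z ∈ M.commutant, ∃ i, z (ξ i) = η},
      inner ℂ ζ (w ((x : H →L[ℂ] H) η)) = inner ℂ ζ ((x : H →L[ℂ] H) (w η)) := by
    intro η hη ζ hζ
    induction hη using Submodule.span_induction with
    | mem η hη =>
      induction hζ using Submodule.span_induction with
      | mem ζ hζ =>
        obtain ⟨a, ha, i, rfl⟩ := hη
        obtain ⟨b, hb, j, rfl⟩ := hζ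
        rw [VonNeumannAlgebra.mem_commutant_iff] at ha hb
        have ha' : ∀ m : M, ∀ k : H, (m : H →L[ℂ] H) (a k) = a ((m : H →L[ℂ] H) k) := fun m k =>
          DFunLike.congr_fun (ha m m.2) k
        have hb' : ∀ m : M, ∀ k : H, star (m : H →L[ℂ] H) (b k) = b (star (m : H →L[ℂ] H) k) :=
          fun m k => DFunLike.congr_fun (hb _ (star_mem m.2)) k
        have e1 : Tendsto (fun n => inner ℂ (b (ξ j)) (w ((y n : H →L[ℂ] H) (a (ξ i))))) atTop
            (𝓝 (inner ℂ (b (ξ j)) (w ((x : H →L[ℂ] H) (a (ξ i)))))) := by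
          simp only [ha']
          exact Tendsto.inner tendsto_const_nhds (((w ∘L a).continuous.tendsto _).comp (h1 i))
        have e2 : Tendsto (fun n => inner ℂ (b (ξ j)) ((y n : H →L[ℂ] H) (w (a (ξ i))))) atTop
            (𝓝 (inner ℂ (b (ξ j)) ((x : H →L[ℂ] H) (w (a (ξ i)))))) := by
          have e3 : ∀ m : M, inner ℂ (b (ξ j)) ((m : H →L[ℂ] H) (w (a (ξ i)))) =
              inner ℂ (b (star (m : H →L[ℂ] H) (ξ j))) (w (a (ξ i))) := fun m => by
            rw [← hb', ContinuousLinearMap.star_eq_adjoint,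
              ContinuousLinearMap.adjoint_inner_left]
          simp only [e3]
          exact Tendsto.inner ((b.continuous.tendsto _).comp (h2 j)) tendsto_const_nhds
        refine tendsto_nhds_unique e1 (e2.congr fun n => ?_)
        have := DFunLike.congr_fun (hw _ (hyN n)) (a (ξ i))
        exact congrArg _ this
      | zero => simp
      | add a b _ _ ha hb => simp only [inner_add_left, ha, hb]
      | smul c a _ ha => simp only [inner_smul_left, ha]
    | zero => simp
    | add a b _ _ ha hb => simp only [map_add, inner_add_right, ha, hb]
    | smul c a _ ha => simp only [map_smul, inner_smul_right, ha]
  have hdense : Dense (Submodule.span ℂ {η : H | ∃ z ∈ M.commutant, ∃ i, z (ξ i) = η} : Set H) :=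
    Submodule.dense_iff_topologicalClosure_eq_top.mpr (hτ.commutant_cyclic hξ)
  refine ContinuousLinearMap.ext_on (f := w * (x : H →L[ℂ] H)) (g := (x : H →L[ℂ] H) * w)
    (s := (Submodule.span ℂ {η : H | ∃ z ∈ M.commutant, ∃ i, z (ξ i) = η} : Set H))
    (by rwa [Submodule.span_eq]) fun η hη => ?_
  exact hdense.eq_of_inner_right ℂ fun ζ hζ => key η hη ζ hζ

/-- The `L²(M, τ)` form of the density theorem for bicommutants. -/
theorem gnsEmbedding_mem_closure (hτ : IsFaithfulNormalTracialState τ)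
    {S : Set (H →L[ℂ] H)} {E : Submodule ℂ (H →L[ℂ] H)} (hEM : ∀ e ∈ E, e ∈ M)
    (h1 : 1 ∈ E) (hE : ∀ s ∈ S ∪ star S, ∀ e ∈ E, s * e ∈ E)
    {x : M} (hx : (x : H →L[ℂ] H) ∈ vonNeumannGenerated S) :
    gnsEmbedding τ x ∈ closure (gnsEmbedding τ '' {y : M | (y : H →L[ℂ] H) ∈ E}) := by
  obtain ⟨ξ, hsum, hξ⟩ := hτ.normal
  obtain ⟨Ω, hΩ⟩ : ∃ Ω : lp (fun _ : ℕ => H) 2, ∀ i, Ω i = ξ i :=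
    ⟨⟨ξ, memℓp_two_iff_summable.mpr hsum⟩, fun _ => rfl⟩
  have hdist : ∀ y : M, dist (gnsEmbedding τ x) (gnsEmbedding τ y) =
      dist (amplification (x : H →L[ℂ] H) Ω) (amplification (y : H →L[ℂ] H) Ω) := fun y => by
    rw [dist_eq_norm, dist_eq_norm, ← map_sub, ← sq_eq_sq₀ (norm_nonneg _) (norm_nonneg _)]
    refine (hτ.hasSum_norm_sq hξ (x - y)).unique ?_
    convert lp.hasSum_norm_sq (amplification (x : H →L[ℂ] H) Ω - amplification (y : H →L[ℂ] H) Ω)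
      using 4 with i
    rw [lp.coeFn_sub, Pi.sub_apply, amplification_apply, amplification_apply, hΩ]
    rfl
  have hcl := amplification_mem_closure h1 hE hx Ω
  rw [Metric.mem_closure_iff] at hcl ⊢
  intro ε hε
  obtain ⟨_, ⟨e, he, rfl⟩, hlt⟩ := hcl ε hε
  exact ⟨_, ⟨⟨e, hEM e he⟩, he, rfl⟩, (hdist _).trans_lt hlt⟩

end IsFaithfulNormalTracialState

end TraceSpace

/-! ### Measures and Fourier coefficients on the circle -/

section CircleMeasures

theorem continuous_circle_zpow (k : ℤ) : Continuous fun z : Circle => (z : ℂ) ^ k :=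
  Continuous.zpow₀ (by fun_prop) k fun z => Or.inl (Circle.coe_ne_zero z)

theorem norm_circle_zpow (z : Circle) (k : ℤ) : ‖(z : ℂ) ^ k‖ = 1 := by
  rw [norm_zpow, Circle.norm_coe, one_zpow]

theorem conj_circle_zpow (z : Circle) (k : ℤ) :
    (starRingEnd ℂ) ((z : ℂ) ^ k) = (z : ℂ) ^ (-k) := by
  rw [map_zpow₀, ← Circle.coe_inv_eq_conj, Circle.coe_inv, inv_zpow, zpow_neg]

theorem integrable_circle_zpow (μ : Measure Circle) [IsFiniteMeasure μ] (k : ℤ) :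
    Integrable (fun z : Circle => (z : ℂ) ^ k) μ :=
  Integrable.of_bound (continuous_circle_zpow k).aestronglyMeasurable 1
    (Filter.Eventually.of_forall fun z => (norm_circle_zpow z k).le)

theorem MeasureTheory.Integrable.mul_circle_zpow {μ : Measure Circle} {f : Circle → ℂ}
    (hf : Integrable f μ) (k : ℤ) : Integrable (fun z : Circle => f z * (z : ℂ) ^ k) μ :=
  hf.mul_bdd (c := 1) (continuous_circle_zpow k).aestronglyMeasurable
    (Filter.Eventually.of_forall fun z => (norm_circle_zpow z k).le)

/-- A finite measure on the circle is determined by its moments. -/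
theorem MeasureTheory.Measure.ext_of_circle_moments {μ ν : Measure Circle} [IsFiniteMeasure μ]
    [IsFiniteMeasure ν] (h : ∀ k : ℤ, ∫ z : Circle, (z : ℂ) ^ k ∂μ = ∫ z : Circle, (z : ℂ) ^ k ∂ν) :
    μ = ν := by
  let z : BoundedContinuousFunction Circle ℂ :=
    BoundedContinuousFunction.mkOfCompact ⟨fun z : Circle => (z : ℂ), by fun_prop⟩
  have hz : ∀ g ∈ Submonoid.closure ({z} ∪ star {z}), ∃ k : ℤ, ∀ x : Circle, g x = (x : ℂ) ^ k := by
    intro g hg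
    induction hg using Submonoid.closure_induction with
    | mem g hg =>
      rcases hg with rfl | hg
      · exact ⟨1, fun x => (zpow_one _).symm⟩
      · rw [Set.star_singleton, Set.mem_singleton_iff] at hg
        subst hg
        refine ⟨-1, fun x => ?_⟩
        have := conj_circle_zpow x 1
        rwa [zpow_one] at this
    | one => exact ⟨0, fun x => by simp⟩
    | mul g h _ _ hg hh =>
      obtain ⟨k, hk⟩ := hg
      obtain ⟨l, hl⟩ := hh
      exact ⟨k + l, fun x => by simp [hk, hl, zpow_add₀ (Circle.coe_ne_zero x)]⟩
  refine ext_of_forall_mem_subalgebra_integral_eq_of_polish (𝕜 := ℂ)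
    (A := StarAlgebra.adjoin ℂ {z}) (fun x y hxy => ⟨fun x => (x : ℂ),
      ⟨_, ⟨z, StarAlgebra.self_mem_adjoin_singleton ℂ z, rfl⟩, rfl⟩, fun h => hxy (Circle.ext h)⟩)
    fun g hg => ?_
  rw [← SetLike.mem_coe] at hg
  replace hg : g ∈ Submodule.span ℂ
      (Submonoid.closure ({z} ∪ star {z}) : Set (BoundedContinuousFunction Circle ℂ)) := by
    rw [← StarAlgebra.adjoin_eq_span]
    exact hg
  induction hg using Submodule.span_induction with
  | mem g hg =>
    obtain ⟨k, hk⟩ := hz g hg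
    simp only [hk, h k]
  | zero => simp
  | add g h _ _ hg hh =>
    simp only [BoundedContinuousFunction.coe_add, Pi.add_apply]
    rw [integral_add (g.integrable μ) (h.integrable μ),
      integral_add (g.integrable ν) (h.integrable ν), hg, hh]
  | smul c g _ hg =>
    simp only [BoundedContinuousFunction.coe_smul]
    rw [integral_smul, integral_smul, hg]

instance : IsProbabilityMeasure circleMeasure :=
  ⟨by rw [circleMeasure]; exact Measure.haarMeasure_self⟩

instance : circleMeasure.IsMulLeftInvariant := by
  rw [circleMeasure]; infer_instance

theorem integral_circle_zpow (k : ℤ) :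
    ∫ z : Circle, (z : ℂ) ^ k ∂circleMeasure = if k = 0 then 1 else 0 := by
  split_ifs with hk
  · simp [hk]
  · -- Rotation by `e^{iπ/k}` changes the sign of the integrand.
    have h := integral_mul_left_eq_self (μ := circleMeasure) (fun z : Circle => (z : ℂ) ^ k)
      (Circle.exp (Real.pi / k))
    have hw : ((Circle.exp (Real.pi / k) : Circle) : ℂ) ^ k = -1 := by
      rw [Circle.coe_exp, ← Complex.exp_int_mul]
      convert Complex.exp_pi_mul_I using 2
      push_cast
      field_simp
    simp only [Circle.coe_mul, mul_zpow, hw, neg_one_mul, integral_neg] at h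
    exact self_eq_neg.mp h.symm

/-- An integrable function on the circle is determined by its Fourier coefficients. -/
theorem ae_eq_zero_of_integral_zpow_eq_zero {f : Circle → ℂ} (hf : Integrable f circleMeasure)
    (h : ∀ k : ℤ, ∫ z, f z * (z : ℂ) ^ k ∂circleMeasure = 0) : f =ᵐ[circleMeasure] 0 := by
  have hreal : ∀ g : Circle → ℝ, Integrable g circleMeasure →
      (∀ k : ℤ, ∫ z, (g z : ℂ) * (z : ℂ) ^ k ∂circleMeasure = 0) → g =ᵐ[circleMeasure] 0 := by
    intro g hg hk
    have hpos : ∀ g : Circle → ℝ, Integrable g circleMeasure →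
      IsFiniteMeasure (circleMeasure.withDensity fun z => ENNReal.ofReal (g z)) := fun g hg =>
        isFiniteMeasure_withDensity_ofReal hg.2
    have hint : ∀ g : Circle → ℝ, Integrable g circleMeasure → ∀ k : ℤ,
        ∫ z : Circle, (z : ℂ) ^ k ∂(circleMeasure.withDensity fun z => ENNReal.ofReal (g z)) =
        ∫ z : Circle, ((max (g z) 0 : ℝ) : ℂ) * (z : ℂ) ^ k ∂circleMeasure := fun g hg k => by
      rw [integral_withDensity_eq_integral_toReal_smul₀ hg.1.aemeasurable.ennreal_ofReal
        (Filter.Eventually.of_forall fun z => ENNReal.ofReal_lt_top)]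
      simp [ENNReal.toReal_ofReal']
    have := hpos g hg
    have := hpos (-g) hg.neg
    have heq : (circleMeasure.withDensity fun z => ENNReal.ofReal (g z)) =
        circleMeasure.withDensity fun z => ENNReal.ofReal ((-g) z) := by
      refine Measure.ext_of_circle_moments fun k => ?_
      rw [hint g hg, hint _ hg.neg, ← sub_eq_zero, ← integral_sub]
      · rw [← hk k]
        refine integral_congr_ae (Filter.Eventually.of_forall fun z => ?_)
        simp only
        rw [← sub_mul, ← Complex.ofReal_sub]
        congr 2
        rcases le_total (g z) 0 with hz | hz <;> simp [hz]
      · exact hg.pos_part.ofReal.mul_circle_zpow k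
      · exact hg.neg.pos_part.ofReal.mul_circle_zpow k
    rw [withDensity_eq_iff hg.1.aemeasurable.ennreal_ofReal
      hg.neg.1.aemeasurable.ennreal_ofReal hg.lintegral_lt_top.ne] at heq
    filter_upwards [heq] with z hz
    have := congrArg ENNReal.toReal hz
    rw [ENNReal.toReal_ofReal', ENNReal.toReal_ofReal'] at this
    rcases le_total (g z) 0 with hz | hz <;> simp_all
  have hconj : ∀ k : ℤ, ∫ z, (starRingEnd ℂ) (f z) * (z : ℂ) ^ k ∂circleMeasure = 0 := fun k => by
    have := congrArg (starRingEnd ℂ) (h (-k))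
    rw [← integral_conj] at this
    simpa only [map_mul, conj_circle_zpow, neg_neg, map_zero] using this
  have hfc : Integrable (fun z => (starRingEnd ℂ) (f z)) circleMeasure :=
    (LinearIsometryEquiv.integrable_comp_iff Complex.conjLIE).mpr hf
  have hre := hreal (fun z => (f z).re) hf.re fun k => by
    have := (integral_add (hf.mul_circle_zpow k) (hfc.mul_circle_zpow k)).trans
      (by rw [h, hconj, add_zero])
    simp only [← add_mul, Complex.add_conj] at this
    simpa [mul_assoc, integral_const_mul] using this
  have him := hreal (fun z => (f z).im) hf.im fun k => by
    have := (integral_sub (hf.mul_circle_zpow k) (hfc.mul_circle_zpow k)).trans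
      (by rw [h, hconj, sub_zero])
    simp only [← sub_mul, Complex.sub_conj] at this
    have h2 : (2 * Complex.I) * ∫ z, ((f z).im : ℂ) * (z : ℂ) ^ k ∂circleMeasure = 0 := by
      rw [← integral_const_mul, ← this]
      refine integral_congr_ae (Filter.Eventually.of_forall fun z => ?_)
      simp only
      push_cast
      ring
    simpa using h2
  filter_upwards [hre, him] with z h1 h2
  exact Complex.ext h1 h2

end CircleMeasures

/-! ### Borel functions of a unitary -/

section FunctionsOfUnitary

variable {H : Type*} [NormedAddCommGroup H] [InnerProductSpace ℂ H] [CompleteSpace H]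

theorem inner_unitary_unitary (w : unitary (H →L[ℂ] H)) (x y : H) :
    inner ℂ ((w : H →L[ℂ] H) x) ((w : H →L[ℂ] H) y) = inner ℂ x y := by
  rw [← ContinuousLinearMap.adjoint_inner_right, ← ContinuousLinearMap.star_eq_adjoint]
  exact congrArg (inner ℂ x) (DFunLike.congr_fun w.2.1 y)

theorem unitary_mul_zpow_apply (v : unitary (H →L[ℂ] H)) (k l : ℤ) (x : H) :
    ((v ^ k : unitary (H →L[ℂ] H)) : H →L[ℂ] H) (((v ^ l : unitary (H →L[ℂ] H)) : H →L[ℂ] H) x) =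
      ((v ^ (k + l) : unitary (H →L[ℂ] H)) : H →L[ℂ] H) x := by
  rw [zpow_add]; rfl

theorem inner_zpow_left (v : unitary (H →L[ℂ] H)) (k : ℤ) (x y : H) :
    inner ℂ (((v ^ k : unitary (H →L[ℂ] H)) : H →L[ℂ] H) x) y =
      inner ℂ x (((v ^ (-k) : unitary (H →L[ℂ] H)) : H →L[ℂ] H) y) := by
  rw [← inner_unitary_unitary (v ^ (-k)), unitary_mul_zpow_apply, neg_add_cancel, zpow_zero]
  rfl

theorem IsFunctionOfUnitary.commute_unitary {v w : unitary (H →L[ℂ] H)} {f : Circle → ℂ}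
    {T : H →L[ℂ] H} (hT : IsFunctionOfUnitary v f T) (hw : Commute v w) :
    (w : H →L[ℂ] H) * T = T * w := by
  -- The spectral measures of `v` at `w ξ` and at `ξ` agree, so `w* T w` is also `f(v)`.
  have h : IsFunctionOfUnitary v f (star (w : H →L[ℂ] H) * T * w) := fun ξ => by
    obtain ⟨μ, hμ, hfμ, hint⟩ := hT ((w : H →L[ℂ] H) ξ)
    refine ⟨μ, ⟨hμ.1, fun k => ?_⟩, hfμ, ?_⟩
    · rw [hμ.2 k, ← inner_unitary_unitary w ξ]
      have := congrArg (fun a : unitary (H →L[ℂ] H) => (a : H →L[ℂ] H) ξ) (hw.zpow_left k).eq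
      exact congrArg _ this
    · rw [hint]
      exact (ContinuousLinearMap.adjoint_inner_right _ _ _).symm
  have h2 := hT.unique h
  have hw2 : (w : H →L[ℂ] H) * star (w : H →L[ℂ] H) = 1 := w.2.2
  calc (w : H →L[ℂ] H) * T = w * (star (w : H →L[ℂ] H) * T * w) := by rw [← h2]
    _ = T * w := by rw [← mul_assoc, ← mul_assoc, hw2, one_mul]

/-- `f(v)` belongs to `W*(v)`: the commutant of `v` is spanned by its unitaries. -/
theorem IsFunctionOfUnitary.mem_vonNeumannGenerated {v : unitary (H →L[ℂ] H)} {f : Circle → ℂ}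
    {T : H →L[ℂ] H} (hT : IsFunctionOfUnitary v f T) :
    T ∈ vonNeumannGenerated {(v : H →L[ℂ] H)} := by
  let C := (vonNeumannGenerated {(v : H →L[ℂ] H)}).commutant
  have hC : ∀ y : C, (y : H →L[ℂ] H) * T = T * y := fun y => by
    have hy : y ∈ Submodule.span ℂ (unitary C : Set C) := by
      rw [CStarAlgebra.span_unitary]; trivial
    induction hy using Submodule.span_induction with
    | mem w hw =>
      have hw' : (w : H →L[ℂ] H) ∈ unitary (H →L[ℂ] H) :=
        ⟨congrArg Subtype.val hw.1, congrArg Subtype.val hw.2⟩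
      refine hT.commute_unitary (w := ⟨_, hw'⟩) (Subtype.ext ?_)
      exact VonNeumannAlgebra.mem_commutant_iff.mp w.2 _ (subset_vonNeumannGenerated _ rfl)
    | zero => simp
    | add a b _ _ ha hb => simp only [AddMemClass.coe_add, add_mul, mul_add, ha, hb]
    | smul c a _ ha =>
      change (c • (a : H →L[ℂ] H)) * T = T * (c • (a : H →L[ℂ] H))
      rw [smul_mul_assoc, mul_smul_comm, ha]
  exact VonNeumannAlgebra.mem_of_forall_commutant fun y hy =>
    hC ⟨y, VonNeumannAlgebra.mem_commutant_iff.mpr hy⟩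

/-- The density `|1 + c zᵏ|²`. -/
def trinomialDensity (c : ℂ) (k : ℤ) (z : Circle) : NNReal := ‖1 + c * (z : ℂ) ^ k‖₊ ^ 2

theorem measurable_trinomialDensity (c : ℂ) (k : ℤ) : Measurable (trinomialDensity c k) :=
  (continuous_const.add (continuous_const.mul (continuous_circle_zpow k))).nnnorm.pow 2 |>.measurable

theorem trinomialDensity_smul (c : ℂ) (k : ℤ) (z : Circle) (w : ℂ) :
    trinomialDensity c k z • w =
      (1 + (starRingEnd ℂ) c * c) * w + c * (w * (z : ℂ) ^ k) +
        (starRingEnd ℂ) c * (w * (z : ℂ) ^ (-k)) := by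
  have e1 : trinomialDensity c k z • w = ((‖1 + c * (z : ℂ) ^ k‖ ^ 2 : ℝ) : ℂ) * w := by
    rw [NNReal.smul_def, Complex.real_smul, trinomialDensity]; push_cast; rfl
  rw [e1, Complex.ofReal_pow, ← Complex.conj_mul', map_add, map_mul, conj_circle_zpow, map_one,
    zpow_neg]
  have hz : (z : ℂ) ^ k ≠ 0 := zpow_ne_zero _ (Circle.coe_ne_zero z)
  field_simp
  ring

theorem integral_withDensity_trinomialDensity {μ : Measure Circle} {f : Circle → ℂ}
    (hf : Integrable f μ) (c : ℂ) (k : ℤ) :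
    ∫ z, f z ∂(μ.withDensity fun z => (trinomialDensity c k z : ℝ≥0∞)) =
      (1 + (starRingEnd ℂ) c * c) * ∫ z, f z ∂μ + c * ∫ z, f z * (z : ℂ) ^ k ∂μ +
        (starRingEnd ℂ) c * ∫ z, f z * (z : ℂ) ^ (-k) ∂μ := by
  have h1 := hf.const_mul (1 + (starRingEnd ℂ) c * c)
  have h2 := (hf.mul_circle_zpow k).const_mul c
  have h3 := (hf.mul_circle_zpow (-k)).const_mul ((starRingEnd ℂ) c)
  rw [integral_withDensity_eq_integral_smul (measurable_trinomialDensity c k)]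
  simp only [trinomialDensity_smul]
  rw [← integral_const_mul, ← integral_const_mul, ← integral_const_mul, ← integral_add h1 h2]
  exact integral_add (h1.add h2) h3

/-- The spectral measure of `v` at `ξ + c vᵏ ξ` is that at `ξ` multiplied by `|1 + c zᵏ|²`. By
polarization this gives the off-diagonal spectral measures at `ξ` and `vᵏ ξ`. -/
theorem IsSpectralMeasure.withDensity {v : unitary (H →L[ℂ] H)} {ξ : H} {μ : Measure Circle}
    (hμ : IsSpectralMeasure v ξ μ) (c : ℂ) (k : ℤ) :
    IsSpectralMeasure v (ξ + c • ((v ^ k : unitary (H →L[ℂ] H)) : H →L[ℂ] H) ξ)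
      (μ.withDensity fun z => (trinomialDensity c k z : ℝ≥0∞)) := by
  have := hμ.1
  refine ⟨⟨?_⟩, fun j => ?_⟩
  · rw [withDensity_apply _ MeasurableSet.univ, Measure.restrict_univ]
    have hb : ∀ z : Circle, (trinomialDensity c k z : ℝ≥0∞) ≤ (((1 + ‖c‖₊) ^ 2 : NNReal) : ℝ≥0∞) :=
      fun z => by
        refine ENNReal.coe_le_coe.mpr (pow_le_pow_left₀ zero_le ((nnnorm_add_le _ _).trans ?_) 2)
        have : ‖(z : ℂ) ^ k‖₊ = 1 := NNReal.eq (norm_circle_zpow z k)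
        rw [nnnorm_mul, this, nnnorm_one, mul_one]
    refine (lintegral_mono hb).trans_lt ?_
    rw [lintegral_const]
    exact ENNReal.mul_lt_top ENNReal.coe_lt_top (measure_lt_top _ _)
  · rw [integral_withDensity_trinomialDensity (integrable_circle_zpow μ j)]
    simp only [← zpow_add₀ (Circle.coe_ne_zero _)]
    rw [hμ.2, hμ.2, hμ.2]
    simp only [map_add, map_smul, inner_add_left, inner_add_right, inner_smul_left,
      inner_smul_right, inner_zpow_left, unitary_mul_zpow_apply]
    rw [show -k + (j + k) = j by ring, show -k + j = j + -k by ring]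
    ring

/-- The sesquilinear form of `f(v)` at `(vᵏ ξ, ξ)`, obtained from its quadratic form by
polarization. -/
theorem IsFunctionOfUnitary.integral_mul_zpow {v : unitary (H →L[ℂ] H)} {f : Circle → ℂ}
    {T : H →L[ℂ] H} (hT : IsFunctionOfUnitary v f T) {ξ : H} {μ : Measure Circle}
    (hμ : IsSpectralMeasure v ξ μ) (k : ℤ) : Integrable f μ ∧
    ∫ z, f z * (z : ℂ) ^ (-k) ∂μ =
      inner ℂ (((v ^ k : unitary (H →L[ℂ] H)) : H →L[ℂ] H) ξ) (T ξ) := by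
  have hf : Integrable f μ := by
    obtain ⟨ν, hν, hfν, -⟩ := hT ξ
    rwa [hμ.unique hν]
  refine ⟨hf, ?_⟩
  set η := ((v ^ k : unitary (H →L[ℂ] H)) : H →L[ℂ] H) ξ with hη
  have hQ : ∀ c : ℂ, inner ℂ (ξ + c • η) (T (ξ + c • η)) =
      (1 + (starRingEnd ℂ) c * c) * ∫ z, f z ∂μ + c * ∫ z, f z * (z : ℂ) ^ k ∂μ +
        (starRingEnd ℂ) c * ∫ z, f z * (z : ℂ) ^ (-k) ∂μ := fun c => by
    obtain ⟨ν, hν, -, hint⟩ := hT (ξ + c • η)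
    rw [← hint, hν.unique (hμ.withDensity c k), integral_withDensity_trinomialDensity hf]
  have h1 := hQ 1
  have h2 := hQ (-1)
  have h3 := hQ Complex.I
  have h4 := hQ (-Complex.I)
  simp only [map_add, map_smul, inner_add_left, inner_add_right, inner_smul_left,
    inner_smul_right, map_one, map_neg, Complex.conj_I] at h1 h2 h3 h4
  linear_combination (-1/4) * h1 + (1/4) * h2 - (Complex.I / 4) * h3 + (Complex.I / 4) * h4 +
    (1 / 2) * ((∫ z, f z * (z : ℂ) ^ (-k) ∂μ) - (∫ z, f z * (z : ℂ) ^ k ∂μ) -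
      inner ℂ η (T ξ) + inner ℂ ξ (T η)) * Complex.I_sq

variable {M : VonNeumannAlgebra H} {τ : M →ₚ[ℂ] ℂ}

theorem VonNeumannAlgebra.zpow_mem {v : unitary (H →L[ℂ] H)} (hv : (v : H →L[ℂ] H) ∈ M) (k : ℤ) :
    ((v ^ k : unitary (H →L[ℂ] H)) : H →L[ℂ] H) ∈ M := by
  rcases k with k | k
  · simpa using pow_mem hv k
  · rw [zpow_negSucc, ← Unitary.star_eq_inv]
    simpa using star_mem (pow_mem hv (k + 1))

/-- If the traces of the powers of `v` are those of a Haar unitary, then the distribution of `v`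
with respect to the trace is the Haar measure. -/
theorem sum_spectralMeasure_eq {v : unitary (H →L[ℂ] H)} {ξ : ℕ → H}
    (hsum : Summable fun i => ‖ξ i‖ ^ 2) {μ : ℕ → Measure Circle}
    (hμ : ∀ i, IsSpectralMeasure v (ξ i) (μ i))
    (hv : ∀ k : ℤ, HasSum
      (fun i => inner ℂ (ξ i) (((v ^ k : unitary (H →L[ℂ] H)) : H →L[ℂ] H) (ξ i)))
      (if k = 0 then 1 else 0)) : Measure.sum μ = circleMeasure := by
  have hfin : ∀ i, IsFiniteMeasure (μ i) := fun i => (hμ i).1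
  have hmass : ∀ i, (μ i).real Set.univ = ‖ξ i‖ ^ 2 := fun i => by
    have := (hμ i).2 0
    simp only [zpow_zero, integral_const, mul_one, Complex.real_smul] at this
    rw [← Complex.ofReal_inj, this]
    change inner ℂ (ξ i) (ξ i) = _
    rw [inner_self_eq_norm_sq_to_K]
    norm_cast
  have hsumfin : IsFiniteMeasure (Measure.sum μ) := ⟨by
    rw [Measure.sum_apply _ MeasurableSet.univ]
    have : ∀ i, μ i Set.univ = ENNReal.ofReal (‖ξ i‖ ^ 2) := fun i => by
      rw [← hmass, ofReal_measureReal]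
    simp only [this]
    rw [← ENNReal.ofReal_tsum_of_nonneg (fun _ => by positivity) hsum]
    exact ENNReal.ofReal_lt_top⟩
  refine Measure.ext_of_circle_moments fun j => ?_
  rw [integral_circle_zpow]
  refine (hasSum_integral_measure (integrable_circle_zpow _ j)).unique ?_
  simp only [(hμ _).2]
  exact hv j

/-- For a Haar unitary `v`, the traces `τ(v⁻ᵏ f(v))` are the Fourier coefficients of `f`. -/
theorem IsFaithfulNormalTracialState.trace_zpow_mul_function (hτ : IsFaithfulNormalTracialState τ)
    {v : unitary (H →L[ℂ] H)}
    (hv : ∀ k : ℤ, ∃ y : M, (y : H →L[ℂ] H) = (v ^ k : unitary (H →L[ℂ] H)) ∧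
      τ y = if k = 0 then 1 else 0)
    {f : Circle → ℂ} (hf : Integrable f circleMeasure)
    {T : H →L[ℂ] H} (hT : IsFunctionOfUnitary v f T) (k : ℤ) (x : M)
    (hx : (x : H →L[ℂ] H) = star ((v ^ k : unitary (H →L[ℂ] H)) : H →L[ℂ] H) * T) :
    τ x = circleFourierCoeff f k := by
  obtain ⟨ξ, hsum, hξ⟩ := hτ.normal
  choose μ hμ _ _ using fun i => hT (ξ i)
  have hsum_eq : Measure.sum μ = circleMeasure := sum_spectralMeasure_eq hsum hμ fun k => by
    obtain ⟨y, hy, hy'⟩ := hv k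
    have := hξ y
    rwa [hy, hy'] at this
  have h1 : HasSum (fun i => ∫ z, f z * (z : ℂ) ^ (-k) ∂(μ i)) (circleFourierCoeff f k) := by
    have h := hf.mul_circle_zpow (-k)
    rw [circleFourierCoeff, ← hsum_eq]
    rw [← hsum_eq] at h
    exact hasSum_integral_measure h
  have h2 : ∀ i, ∫ z, f z * (z : ℂ) ^ (-k) ∂(μ i) =
      inner ℂ (ξ i) ((x : H →L[ℂ] H) (ξ i)) := fun i => by
    rw [(hT.integral_mul_zpow (hμ i) k).2, hx]
    exact (ContinuousLinearMap.adjoint_inner_right _ _ _).symm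
  simp only [h2] at h1
  exact (hξ x).unique h1

end FunctionsOfUnitary

/-! ### Pairs of unitaries commuting up to a scalar -/

section GNSIsometry

variable {H : Type*} [NormedAddCommGroup H] [InnerProductSpace ℂ H] [CompleteSpace H]
  {N M : VonNeumannAlgebra H} {σ : N →ₚ[ℂ] ℂ} {τ : M →ₚ[ℂ] ℂ}

theorem norm_gnsEmbedding (τ : M →ₚ[ℂ] ℂ) (x : M) : ‖gnsEmbedding τ x‖ = ‖τ.toPreGNS x‖ :=
  UniformSpace.Completion.norm_coe (E := τ.PreGNS) _

/-- A linear map that preserves the trace norm extends to an isometry of the GNS spaces. -/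
theorem exists_gns_isometry (φ : N →ₗ[ℂ] M)
    (h : ∀ x, ‖gnsEmbedding τ (φ x)‖ = ‖gnsEmbedding σ x‖) :
    ∃ W : σ.GNS →ₗᵢ[ℂ] τ.GNS, ∀ x, W (gnsEmbedding σ x) = gnsEmbedding τ (φ x) := by
  have h' : ∀ x : σ.PreGNS, ‖τ.toPreGNS (φ (σ.ofPreGNS x))‖ = ‖x‖ := fun x => by
    have := h (σ.ofPreGNS x)
    rwa [norm_gnsEmbedding, norm_gnsEmbedding] at this
  let pre : σ.PreGNS →L[ℂ] τ.PreGNS :=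
    (τ.toPreGNS.toLinearMap ∘ₗ φ ∘ₗ σ.ofPreGNS.toLinearMap).mkContinuous 1 fun x => by
      rw [one_mul]
      exact (h' x).le
  have hpre : ∀ x, ‖pre.completion x‖ = ‖x‖ := fun x => by
    induction x using UniformSpace.Completion.induction_on with
    | hp => exact isClosed_eq (by fun_prop) (by fun_prop)
    | ih x =>
      rw [ContinuousLinearMap.completion_apply_coe, UniformSpace.Completion.norm_coe,
        UniformSpace.Completion.norm_coe]
      exact h' x
  exact ⟨⟨pre.completion.toLinearMap, hpre⟩, fun x => pre.completion_apply_coe _⟩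

theorem IsFaithfulNormalTracialState.map_conj (hτ : IsFaithfulNormalTracialState τ) {w : M}
    (hw : star w * w = 1) (x : M) : τ (w * x * star w) = τ x := by
  rw [hτ.tracial, ← mul_assoc, hw, one_mul]

/-- Conjugation by a unitary of `M`, as an operator on `L²(M, τ)`. -/
theorem IsFaithfulNormalTracialState.exists_conj (hτ : IsFaithfulNormalTracialState τ) {w : M}
    (hw : star w * w = 1) :
    ∃ A : τ.GNS →L[ℂ] τ.GNS, (∀ x, A (gnsEmbedding τ x) = gnsEmbedding τ (w * x * star w)) ∧
      ∀ x, star A (gnsEmbedding τ x) = gnsEmbedding τ (star w * x * w) := by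
  let φ : M →ₗ[ℂ] M :=
    { toFun := fun x => w * x * star w
      map_add' := fun x y => by rw [mul_add, add_mul]
      map_smul' := fun c x => by rw [mul_smul_comm, smul_mul_assoc, RingHom.id_apply] }
  obtain ⟨W, hW⟩ := exists_gns_isometry (σ := τ) (τ := τ) φ fun x => by
    rw [← sq_eq_sq₀ (norm_nonneg _) (norm_nonneg _), ← Complex.ofReal_inj, norm_sq_gnsEmbedding,
      norm_sq_gnsEmbedding, ← hτ.map_conj hw (star x * x)]
    change τ (star (w * x * star w) * (w * x * star w)) = _
    congr 1
    simp only [star_mul, star_star, mul_assoc]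
    rw [← mul_assoc (star w) w, hw, one_mul]
  refine ⟨W.toContinuousLinearMap, hW, fun x => ?_⟩
  refine (denseRange_gnsEmbedding τ).eq_of_inner_left ℂ ?_
  intro y
  rw [ContinuousLinearMap.star_eq_adjoint, ContinuousLinearMap.adjoint_inner_left]
  change inner ℂ _ (W _) = _
  rw [hW, inner_gnsEmbedding, inner_gnsEmbedding]
  change τ (star x * (w * y * star w)) = _
  rw [← mul_assoc, hτ.tracial]
  simp only [star_mul, star_star, mul_assoc]

end GNSIsometry

section RotationPair

variable {H : Type*} [NormedAddCommGroup H] [InnerProductSpace ℂ H] [CompleteSpace H]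

/-- Unitaries `u`, `v` with `v u = ζ u v`, where `ζ` is a complex number of modulus one that is not
a root of unity. -/
structure IsRotationPair (ζ : ℂ) (u v : unitary (H →L[ℂ] H)) : Prop where
  norm_eq : ‖ζ‖ = 1
  zpow_ne : ∀ k : ℤ, k ≠ 0 → ζ ^ k ≠ 1
  comm : (v : H →L[ℂ] H) * u = ζ • ((u : H →L[ℂ] H) * v)

/-- The monomial `uᵃ vᵇ`. -/
def monomial (u v : unitary (H →L[ℂ] H)) (p : ℤ × ℤ) : unitary (H →L[ℂ] H) := u ^ p.1 * v ^ p.2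

theorem coe_monomial (u v : unitary (H →L[ℂ] H)) (a b : ℤ) :
    ((monomial u v (a, b) : unitary (H →L[ℂ] H)) : H →L[ℂ] H) =
      ((u ^ a : unitary (H →L[ℂ] H)) : H →L[ℂ] H) * ((v ^ b : unitary (H →L[ℂ] H))) := rfl

theorem coe_unitary_zpow_add (u : unitary (H →L[ℂ] H)) (a b : ℤ) :
    ((u ^ (a + b) : unitary (H →L[ℂ] H)) : H →L[ℂ] H) =
      ((u ^ a : unitary (H →L[ℂ] H)) : H →L[ℂ] H) * ((u ^ b : unitary (H →L[ℂ] H))) := by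
  rw [zpow_add]; rfl

theorem star_unitary_zpow (u : unitary (H →L[ℂ] H)) (a : ℤ) :
    star ((u ^ a : unitary (H →L[ℂ] H)) : H →L[ℂ] H) = (u ^ (-a) : unitary (H →L[ℂ] H)) := by
  rw [zpow_neg, ← Unitary.star_eq_inv]; rfl

namespace IsRotationPair

variable {ζ : ℂ} {u v : unitary (H →L[ℂ] H)}

theorem ne_zero (h : IsRotationPair ζ u v) : ζ ≠ 0 := fun h0 => by
  have := h.norm_eq
  simp [h0] at this

theorem conj_eq (h : IsRotationPair ζ u v) : (starRingEnd ℂ) ζ = ζ⁻¹ := by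
  rw [Complex.inv_def, Complex.normSq_eq_norm_sq, h.norm_eq]; simp

theorem zpow_mul_zpow (h : IsRotationPair ζ u v) (b a : ℤ) :
    ((v ^ b : unitary (H →L[ℂ] H)) : H →L[ℂ] H) * ((u ^ a : unitary (H →L[ℂ] H))) =
      ζ ^ (b * a) • (((u ^ a : unitary (H →L[ℂ] H)) : H →L[ℂ] H) *
        ((v ^ b : unitary (H →L[ℂ] H)))) := by
  have hζ : (starRingEnd ℂ) ζ * ζ = 1 := by rw [h.conj_eq, inv_mul_cancel₀ h.ne_zero]
  let c : unitary (H →L[ℂ] H) := ⟨ζ • 1, by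
    constructor
    · rw [star_smul, star_one, smul_mul_smul_comm, one_mul]
      change ((starRingEnd ℂ) ζ * ζ) • (1 : H →L[ℂ] H) = 1
      rw [hζ, one_smul]
    · rw [star_smul, star_one, smul_mul_smul_comm, one_mul, mul_comm]
      change ((starRingEnd ℂ) ζ * ζ) • (1 : H →L[ℂ] H) = 1
      rw [hζ, one_smul]⟩
  have hcoe : ∀ n : ℤ, ((c ^ n : unitary (H →L[ℂ] H)) : H →L[ℂ] H) = ζ ^ n • 1 := by
    have hinv : ((c⁻¹ : unitary (H →L[ℂ] H)) : H →L[ℂ] H) = ζ⁻¹ • 1 := by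
      rw [← Unitary.star_eq_inv, ← h.conj_eq]
      change star (ζ • (1 : H →L[ℂ] H)) = _
      rw [star_smul, star_one]
      rfl
    intro n
    induction n using Int.induction_on with
    | zero => simp
    | succ n ih =>
      rw [zpow_add_one, zpow_add_one₀ h.ne_zero, Submonoid.coe_mul, ih]
      change (ζ ^ (n : ℤ) • (1 : H →L[ℂ] H)) * (ζ • 1) = _
      rw [smul_mul_smul_comm, one_mul]
    | pred n ih =>
      rw [zpow_sub_one, zpow_sub_one₀ h.ne_zero, Submonoid.coe_mul, ih, hinv, smul_mul_smul_comm,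
        one_mul]
  have hc : ∀ w : unitary (H →L[ℂ] H), Commute c w := fun w => Subtype.ext <| by
    change (ζ • (1 : H →L[ℂ] H)) * (w : H →L[ℂ] H) = (w : H →L[ℂ] H) * (ζ • 1)
    rw [smul_mul_assoc, mul_smul_comm, one_mul, mul_one]
  have h1 : SemiconjBy v u (c * u) := Subtype.ext <| by
    change (v : H →L[ℂ] H) * u = (ζ • 1) * (u : H →L[ℂ] H) * v
    rw [h.comm, smul_mul_assoc, smul_mul_assoc, one_mul]
  have h2 : SemiconjBy (u ^ a) (c ^ a * v) v := by
    have := h1.zpow_right a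
    rw [(hc u).mul_zpow] at this
    have h3 := this.eq
    rw [SemiconjBy, h3, ← mul_assoc, ((hc (u ^ a)).zpow_left a).eq]
  have h3 := (h2.zpow_right b).eq
  rw [((hc v).zpow_left a).mul_zpow, ← zpow_mul, ← mul_assoc,
    ← ((hc (u ^ a)).zpow_left (a * b)).eq] at h3
  have h4 := congrArg Subtype.val h3
  have h5 : ((v ^ b : unitary (H →L[ℂ] H)) : H →L[ℂ] H) * ((u ^ a : unitary (H →L[ℂ] H))) =
      ((c ^ (a * b) : unitary (H →L[ℂ] H)) : H →L[ℂ] H) * ((u ^ a : unitary (H →L[ℂ] H))) *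
        ((v ^ b : unitary (H →L[ℂ] H))) := h4.symm
  rw [h5, hcoe, smul_mul_assoc, smul_mul_assoc, one_mul, mul_comm a b]

theorem conj_left (h : IsRotationPair ζ u v) (p : ℤ × ℤ) :
    (u : H →L[ℂ] H) * monomial u v p * star (u : H →L[ℂ] H) =
      ζ ^ (-p.2) • (monomial u v p : H →L[ℂ] H) := by
  obtain ⟨a, b⟩ := p
  have h1 := h.zpow_mul_zpow b (-1)
  have hu1 : (u : H →L[ℂ] H) = (u ^ (1 : ℤ) : unitary (H →L[ℂ] H)) := by rw [zpow_one]
  rw [hu1, star_unitary_zpow, coe_monomial, ← mul_assoc, ← coe_unitary_zpow_add, mul_assoc, h1,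
    mul_smul_comm, ← mul_assoc, ← coe_unitary_zpow_add]
  congr 3 <;> ring_nf

theorem conj_right (h : IsRotationPair ζ u v) (p : ℤ × ℤ) :
    (v : H →L[ℂ] H) * monomial u v p * star (v : H →L[ℂ] H) =
      ζ ^ p.1 • (monomial u v p : H →L[ℂ] H) := by
  obtain ⟨a, b⟩ := p
  have h1 := h.zpow_mul_zpow 1 a
  have hu1 : (v : H →L[ℂ] H) = (v ^ (1 : ℤ) : unitary (H →L[ℂ] H)) := by rw [zpow_one]
  rw [hu1, star_unitary_zpow, coe_monomial, ← mul_assoc, h1, smul_mul_assoc, smul_mul_assoc,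
    mul_assoc, mul_assoc, ← coe_unitary_zpow_add, ← coe_unitary_zpow_add]
  congr 3 <;> ring_nf

theorem pow_right (h : IsRotationPair ζ u v) {n : ℕ} (hn : 0 < n) :
    IsRotationPair (ζ ^ n) u (v ^ n) where
  norm_eq := by rw [norm_pow, h.norm_eq, one_pow]
  zpow_ne k hk := by
    rw [← zpow_natCast, ← zpow_mul]
    exact h.zpow_ne _ (mul_ne_zero (by exact_mod_cast hn.ne') hk)
  comm := by
    have := h.zpow_mul_zpow n 1
    simpa using this

end IsRotationPair

end RotationPair

/-! ### The monomial basis of `L²` -/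

section MonomialBasis

variable {H : Type*} [NormedAddCommGroup H] [InnerProductSpace ℂ H] [CompleteSpace H]
  {M : VonNeumannAlgebra H} {τ : M →ₚ[ℂ] ℂ} {ζ : ℂ} {u v : unitary (H →L[ℂ] H)}

theorem monomial_mem (hu : (u : H →L[ℂ] H) ∈ M) (hv : (v : H →L[ℂ] H) ∈ M) (p : ℤ × ℤ) :
    (monomial u v p : H →L[ℂ] H) ∈ M :=
  mul_mem (VonNeumannAlgebra.zpow_mem hu _) (VonNeumannAlgebra.zpow_mem hv _)

/-- The monomial `uᵃ vᵇ` as an element of a von Neumann algebra containing `u` and `v`. -/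
def monomialIn (hu : (u : H →L[ℂ] H) ∈ M) (hv : (v : H →L[ℂ] H) ∈ M) (p : ℤ × ℤ) : M :=
  ⟨monomial u v p, monomial_mem hu hv p⟩

theorem HilbertBasis.eq_smul_of_inner_eq_zero {ι E : Type*} [NormedAddCommGroup E]
    [InnerProductSpace ℂ E] (b : HilbertBasis ι ℂ E) {p : ι} {ξ : E}
    (h : ∀ q ≠ p, inner ℂ (b q) ξ = 0) : ξ = inner ℂ (b p) ξ • b p := by
  have h1 := b.hasSum_repr ξ
  simp only [b.repr_apply_apply] at h1
  exact h1.unique (hasSum_single p fun q hq => by rw [h q hq, zero_smul])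

/-- The elements of `M` that belong to `N`, as a subspace of `M`. -/
def VonNeumannAlgebra.restrictTo (N M : VonNeumannAlgebra H) : Submodule ℂ M where
  carrier := {y : M | (y : H →L[ℂ] H) ∈ N}
  add_mem' {x y} hx hy := show (x : H →L[ℂ] H) + y ∈ N from add_mem hx hy
  zero_mem' := zero_mem N
  smul_mem' c y ha := show c • (y : H →L[ℂ] H) ∈ N from SMulMemClass.smul_mem c ha

namespace IsFaithfulNormalTracialState

/-- Conjugation by `u` and by `v` multiplies `uᵃ vᵇ` by nontrivial scalars unless `a = b = 0`, so
the trace vanishes on the other monomials. -/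
theorem trace_monomialIn (hτ : IsFaithfulNormalTracialState τ) (h : IsRotationPair ζ u v)
    (hu : (u : H →L[ℂ] H) ∈ M) (hv : (v : H →L[ℂ] H) ∈ M) (p : ℤ × ℤ) :
    τ (monomialIn hu hv p) = if p = 0 then 1 else 0 := by
  split_ifs with hp
  · subst hp
    rw [show monomialIn hu hv 0 = 1 from Subtype.ext (mul_one _), hτ.map_one]
  · have key : ∀ (w : unitary (H →L[ℂ] H)) (hw : (w : H →L[ℂ] H) ∈ M) (k : ℤ), k ≠ 0 →
        (w : H →L[ℂ] H) * monomial u v p * star (w : H →L[ℂ] H) =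
          ζ ^ k • (monomial u v p : H →L[ℂ] H) → τ (monomialIn hu hv p) = 0 := by
      intro w hw k hk he
      have h1 := hτ.map_conj (w := ⟨w, hw⟩) (Subtype.ext w.2.1) (monomialIn hu hv p)
      rw [show (⟨w, hw⟩ : M) * monomialIn hu hv p * star (⟨w, hw⟩ : M) =
        ζ ^ k • monomialIn hu hv p from Subtype.ext he, map_smul, smul_eq_mul] at h1
      by_contra h0
      exact h.zpow_ne k hk (mul_right_cancel₀ h0 (h1.trans (one_mul _).symm))
    by_cases ha : p.1 = 0
    · have hb : p.2 ≠ 0 := fun hb => hp (Prod.ext ha hb)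
      exact key u hu (-p.2) (neg_ne_zero.mpr hb) (h.conj_left p)
    · exact key v hv p.1 ha (h.conj_right p)

theorem orthonormal_monomialIn (hτ : IsFaithfulNormalTracialState τ) (h : IsRotationPair ζ u v)
    (hu : (u : H →L[ℂ] H) ∈ M) (hv : (v : H →L[ℂ] H) ∈ M) :
    Orthonormal ℂ fun p => gnsEmbedding τ (monomialIn hu hv p) := by
  classical
  rw [orthonormal_iff_ite]
  rintro ⟨a, b⟩ ⟨c, d⟩
  let V : ℤ → M := fun k => ⟨_, VonNeumannAlgebra.zpow_mem hv k⟩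
  let U : ℤ → M := fun k => ⟨_, VonNeumannAlgebra.zpow_mem hu k⟩
  have e1 : star (monomialIn hu hv (a, b)) * monomialIn hu hv (c, d) =
      V (-b) * (U (c - a) * V d) := Subtype.ext <| by
    change star (monomial u v (a, b) : H →L[ℂ] H) * monomial u v (c, d) = _ * (_ * _)
    rw [coe_monomial, coe_monomial, star_mul, star_unitary_zpow, star_unitary_zpow, mul_assoc,
      ← mul_assoc _ _ ((v ^ d : unitary (H →L[ℂ] H)) : H →L[ℂ] H), ← coe_unitary_zpow_add,
      neg_add_eq_sub]
  have e2 : U (c - a) * V d * V (-b) = monomialIn hu hv (c - a, d - b) := Subtype.ext <| by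
    change ((u ^ (c - a) : unitary (H →L[ℂ] H)) : H →L[ℂ] H) * (v ^ d : unitary (H →L[ℂ] H)) *
      (v ^ (-b) : unitary (H →L[ℂ] H)) = monomial u v (c - a, d - b)
    rw [mul_assoc, ← coe_unitary_zpow_add, coe_monomial, sub_eq_add_neg d b]
  rw [inner_gnsEmbedding, e1, hτ.tracial, e2, hτ.trace_monomialIn h hu hv]
  refine if_congr ?_ rfl rfl
  rw [Prod.mk_eq_zero, sub_eq_zero, sub_eq_zero, Prod.mk.injEq, eq_comm (a := c),
    eq_comm (a := d)]

/-- The span of the monomials is stable under multiplication by `u`, `v` and their adjoints, so the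
density theorem applies to it. -/
theorem span_monomialIn (hτ : IsFaithfulNormalTracialState τ) (h : IsRotationPair ζ u v)
    (hu : (u : H →L[ℂ] H) ∈ M) (hv : (v : H →L[ℂ] H) ∈ M) {x : M}
    (hx : (x : H →L[ℂ] H) ∈ vonNeumannGenerated {(u : H →L[ℂ] H), (v : H →L[ℂ] H)}) :
    gnsEmbedding τ x ∈ (Submodule.span ℂ
      (Set.range fun p => gnsEmbedding τ (monomialIn hu hv p))).topologicalClosure := by
  let ι : M →ₗ[ℂ] (H →L[ℂ] H) := ⟨⟨fun x => x, fun _ _ => rfl⟩, fun _ _ => rfl⟩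
  let E : Submodule ℂ M := Submodule.span ℂ (Set.range (monomialIn hu hv))
  have hmul : ∀ s : M, (∀ p, s * monomialIn hu hv p ∈ E) → ∀ e ∈ E, s * e ∈ E := fun s hs e he => by
    have : E ≤ E.comap (LinearMap.mulLeft ℂ s) := by
      refine Submodule.span_le.mpr ?_
      rintro _ ⟨p, rfl⟩
      exact hs p
    exact this he
  have hU : ∀ k : ℤ, ∀ e ∈ E, (⟨_, VonNeumannAlgebra.zpow_mem hu k⟩ : M) * e ∈ E := fun k =>
    hmul _ fun p => by
      refine Submodule.subset_span ⟨(k + p.1, p.2), Subtype.ext ?_⟩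
      change (monomial u v (k + p.1, p.2) : H →L[ℂ] H) = _ * (monomial u v (p.1, p.2) : H →L[ℂ] H)
      rw [coe_monomial, coe_monomial, coe_unitary_zpow_add, mul_assoc]
  have hV : ∀ k : ℤ, ∀ e ∈ E, (⟨_, VonNeumannAlgebra.zpow_mem hv k⟩ : M) * e ∈ E := fun k =>
    hmul _ fun p => by
      have : (⟨_, VonNeumannAlgebra.zpow_mem hv k⟩ : M) * monomialIn hu hv p =
          ζ ^ (k * p.1) • monomialIn hu hv (p.1, k + p.2) := Subtype.ext <| by
        change _ * (monomial u v (p.1, p.2) : H →L[ℂ] H) =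
          ζ ^ (k * p.1) • (monomial u v (p.1, k + p.2) : H →L[ℂ] H)
        rw [coe_monomial, coe_monomial, coe_unitary_zpow_add, ← mul_assoc, h.zpow_mul_zpow,
          smul_mul_assoc, mul_assoc]
      rw [this]
      exact Submodule.smul_mem _ _ (Submodule.subset_span ⟨_, rfl⟩)
  have hcl := hτ.gnsEmbedding_mem_closure (E := E.map ι) (by rintro _ ⟨e, -, rfl⟩; exact e.2)
    ⟨1, Submodule.subset_span ⟨0, Subtype.ext (mul_one _)⟩, rfl⟩ (by
      rintro s hs _ ⟨e, he, rfl⟩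
      have h1 : ∀ w : unitary (H →L[ℂ] H), (w : H →L[ℂ] H) = (w ^ (1 : ℤ) : unitary (H →L[ℂ] H)) :=
        fun w => by rw [zpow_one]
      rcases hs with (rfl | rfl) | (hs | hs)
      · rw [h1 u]; exact ⟨_, hU 1 e he, rfl⟩
      · rw [h1 v]; exact ⟨_, hV 1 e he, rfl⟩
      · rw [← star_star s, hs, h1 u, star_unitary_zpow]; exact ⟨_, hU (-1) e he, rfl⟩
      · rw [← star_star s, hs, h1 v, star_unitary_zpow]; exact ⟨_, hV (-1) e he, rfl⟩) hx
  refine closure_mono ?_ hcl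
  rintro _ ⟨y, ⟨e, he, hey⟩, rfl⟩
  obtain rfl : e = y := Subtype.ext hey
  have := Submodule.mem_map_of_mem (f := gnsEmbedding τ) he
  rw [Submodule.map_span, ← Set.range_comp] at this
  exact this

/-- The monomials form an orthonormal basis of `L²(W*(u, v), τ)`. -/
theorem exists_monomial_hilbertBasis (hτ : IsFaithfulNormalTracialState τ)
    (h : IsRotationPair ζ u v) (hu : (u : H →L[ℂ] H) ∈ M) (hv : (v : H →L[ℂ] H) ∈ M)
    (hM : M = vonNeumannGenerated {(u : H →L[ℂ] H), (v : H →L[ℂ] H)}) :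
    ∃ b : HilbertBasis (ℤ × ℤ) ℂ τ.GNS, ∀ p, b p = gnsEmbedding τ (monomialIn hu hv p) := by
  refine ⟨HilbertBasis.mk (hτ.orthonormal_monomialIn h hu hv) fun x _ => ?_, fun p => by
    rw [HilbertBasis.coe_mk]⟩
  refine closure_minimal ?_ (Submodule.isClosed_topologicalClosure _) (denseRange_gnsEmbedding τ x)
  rintro _ ⟨y, rfl⟩
  exact hτ.span_monomialIn h hu hv (hM ▸ y.2)

/-- An element of `W*(u, v)` lies in every von Neumann subalgebra containing the monomials that
occur in its Fourier expansion. -/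
theorem mem_of_monomial_mem (hτ : IsFaithfulNormalTracialState τ)
    (h : IsRotationPair ζ u v) (hu : (u : H →L[ℂ] H) ∈ M) (hv : (v : H →L[ℂ] H) ∈ M)
    (hM : M = vonNeumannGenerated {(u : H →L[ℂ] H), (v : H →L[ℂ] H)})
    {N : VonNeumannAlgebra H} {x : M}
    (hx : ∀ p, inner ℂ (gnsEmbedding τ (monomialIn hu hv p)) (gnsEmbedding τ x) ≠ 0 →
      (monomial u v p : H →L[ℂ] H) ∈ N) : (x : H →L[ℂ] H) ∈ N := by
  obtain ⟨b, hb⟩ := hτ.exists_monomial_hilbertBasis h hu hv hM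
  refine hτ.mem_of_mem_closure ?_
  have hsum := b.hasSum_repr (gnsEmbedding τ x)
  refine mem_closure_of_tendsto hsum (Filter.Eventually.of_forall fun s => ?_)
  refine ((N.restrictTo M).map (gnsEmbedding τ)).sum_mem fun p _ => ?_
  rw [b.repr_apply_apply, hb]
  by_cases h0 : inner ℂ (gnsEmbedding τ (monomialIn hu hv p)) (gnsEmbedding τ x) = 0
  · rw [h0, zero_smul]; exact zero_mem _
  · exact Submodule.smul_mem _ _ ⟨_, hx p h0, rfl⟩

/-- If a von Neumann subalgebra `N` of `W*(u, v)` is normalized by `u` and `v`, then the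
projection of `L²` onto the closure of `N` commutes with conjugation by `u` and `v`. The monomials
are joint eigenvectors for distinct eigenvalues, so each of them is fixed or killed, and those that
occur in the Fourier expansion of an element of `N` belong to `N`. -/
theorem monomial_mem_of_inner_ne_zero (hτ : IsFaithfulNormalTracialState τ)
    (h : IsRotationPair ζ u v) (hu : (u : H →L[ℂ] H) ∈ M) (hv : (v : H →L[ℂ] H) ∈ M)
    (hM : M = vonNeumannGenerated {(u : H →L[ℂ] H), (v : H →L[ℂ] H)})
    {N : VonNeumannAlgebra H}
    (hN : ∀ w ∈ ({(u : H →L[ℂ] H), (v : H →L[ℂ] H)} : Set (H →L[ℂ] H)), ∀ y ∈ N,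
      w * y * star w ∈ N ∧ star w * y * w ∈ N) {x : M} (hxN : (x : H →L[ℂ] H) ∈ N) {p : ℤ × ℤ}
    (hp : inner ℂ (gnsEmbedding τ (monomialIn hu hv p)) (gnsEmbedding τ x) ≠ 0) :
    (monomial u v p : H →L[ℂ] H) ∈ N := by
  obtain ⟨b, hb⟩ := hτ.exists_monomial_hilbertBasis h hu hv hM
  let K := ((N.restrictTo M).map (gnsEmbedding τ)).topologicalClosure
  have : CompleteSpace K := ((N.restrictTo M).map (gnsEmbedding τ)).isClosed_topologicalClosure.completeSpace_coe
  -- Monomials with different eigenvalues for conjugation by `w` are orthogonal after projection.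
  have key : ∀ (w : unitary (H →L[ℂ] H)) (hwM : (w : H →L[ℂ] H) ∈ M),
      (w : H →L[ℂ] H) ∈ ({(u : H →L[ℂ] H), (v : H →L[ℂ] H)} : Set (H →L[ℂ] H)) →
      ∀ (q : ℤ × ℤ) (k l : ℤ), k ≠ l →
      (w : H →L[ℂ] H) * monomial u v p * star (w : H →L[ℂ] H) =
        ζ ^ k • (monomial u v p : H →L[ℂ] H) →
      (w : H →L[ℂ] H) * monomial u v q * star (w : H →L[ℂ] H) =
        ζ ^ l • (monomial u v q : H →L[ℂ] H) → inner ℂ (b q) (K.starProjection (b p)) = 0 := by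
    intro w hwM hw q k l hkl ep eq
    obtain ⟨A, hA, hA'⟩ := hτ.exists_conj (w := ⟨w, hwM⟩) (Subtype.ext w.2.1)
    have hcomm := Submodule.commute_starProjection (K := K) (T := A)
      (fun ξ hξ => map_mem_closure A.continuous hξ fun η hη => by
        obtain ⟨y, hy, rfl⟩ := hη
        rw [hA]
        exact ⟨_, (hN w hw y hy).1, rfl⟩)
      (fun ξ hξ => map_mem_closure (star A).continuous hξ fun η hη => by
        obtain ⟨y, hy, rfl⟩ := hη
        rw [hA']
        exact ⟨_, (hN w hw y hy).2, rfl⟩)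
    have hAp : A (b p) = ζ ^ k • b p := by
      rw [hb, hA, ← map_smul]
      exact congrArg _ (Subtype.ext ep)
    have hAq : star A (b q) = ζ ^ (-l) • b q := by
      rw [hb, hA', ← map_smul]
      refine congrArg _ (Subtype.ext ?_)
      change star (w : H →L[ℂ] H) * monomial u v q * w = ζ ^ (-l) • (monomial u v q : H →L[ℂ] H)
      have hw1 : star (w : H →L[ℂ] H) * w = 1 := w.2.1
      calc star (w : H →L[ℂ] H) * monomial u v q * w
          = ζ ^ (-l) • (star (w : H →L[ℂ] H) * (ζ ^ l • (monomial u v q : H →L[ℂ] H)) * w) := by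
            rw [mul_smul_comm, smul_mul_assoc, smul_smul, ← zpow_add₀ h.ne_zero, neg_add_cancel,
              zpow_zero, one_smul]
        _ = _ := by
            rw [← eq]
            simp only [← mul_assoc]
            rw [hw1, one_mul, mul_assoc, hw1, mul_one]
    have h1 : inner ℂ (star A (b q)) (K.starProjection (b p)) =
        inner ℂ (b q) (K.starProjection (A (b p))) := by
      rw [hcomm, ContinuousLinearMap.star_eq_adjoint, ContinuousLinearMap.adjoint_inner_left]
    rw [hAq, hAp, map_smul, inner_smul_left, inner_smul_right, map_zpow₀, h.conj_eq, inv_zpow,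
      zpow_neg, inv_inv] at h1
    by_contra h0
    have h2 := mul_right_cancel₀ h0 h1
    refine h.zpow_ne (l - k) (sub_ne_zero.mpr hkl.symm) ?_
    rw [zpow_sub₀ h.ne_zero, h2, div_self (zpow_ne_zero _ h.ne_zero)]
  have hne : ∀ q, q ≠ p → inner ℂ (b q) (K.starProjection (b p)) = 0 := fun q hq => by
    by_cases hab : q.2 = p.2
    · have : q.1 ≠ p.1 := fun h1 => hq (Prod.ext h1 hab)
      exact key v hv (Or.inr rfl) q p.1 q.1 this.symm (h.conj_right p) (h.conj_right q)
    · exact key u hu (Or.inl rfl) q (-p.2) (-q.2) (fun h => hab (neg_injective h).symm)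
        (h.conj_left p) (h.conj_left q)
  obtain ⟨c, hc⟩ : ∃ c : ℂ, K.starProjection (b p) = c • b p :=
    ⟨_, b.eq_smul_of_inner_eq_zero hne⟩
  have hxK : K.starProjection (gnsEmbedding τ x) = gnsEmbedding τ x :=
    Submodule.starProjection_eq_self_iff.mpr (subset_closure ⟨x, hxN, rfl⟩)
  have h1 := K.inner_starProjection_left_eq_right (b p) (gnsEmbedding τ x)
  rw [hxK, hc, inner_smul_left, hb] at h1
  have hc1 : c = 1 := by
    have := mul_right_cancel₀ hp (h1.trans (one_mul _).symm)
    simpa using congrArg (starRingEnd ℂ) this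
  rw [hc1, one_smul, Submodule.starProjection_eq_self_iff, hb] at hc
  exact hτ.mem_of_mem_closure hc

end IsFaithfulNormalTracialState

end MonomialBasis

/-! ### The Jones index -/

section Index

variable {H : Type*} [NormedAddCommGroup H] [InnerProductSpace ℂ H] [CompleteSpace H]

theorem enorm_sq_eq_ofReal {E : Type*} [NormedAddCommGroup E] (x : E) :
    ‖x‖ₑ ^ 2 = ENNReal.ofReal (‖x‖ ^ 2) := by
  rw [← ofReal_norm, ENNReal.ofReal_pow (norm_nonneg _)]

theorem lp.tsum_enorm_sq {ι : Type*} {E : ι → Type*} [∀ i, NormedAddCommGroup (E i)]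
    (f : lp E 2) : ∑' i, ‖f i‖ₑ ^ 2 = ‖f‖ₑ ^ 2 := by
  simp only [enorm_sq_eq_ofReal]
  rw [← ENNReal.ofReal_tsum_of_nonneg (fun _ => by positivity) (lp.hasSum_norm_sq f).summable,
    (lp.hasSum_norm_sq f).tsum_eq]

theorem HilbertBasis.tsum_enorm_sq_inner {ι E : Type*} [NormedAddCommGroup E]
    [InnerProductSpace ℂ E] (b : HilbertBasis ι ℂ E) (x : E) :
    ∑' i, ‖inner ℂ (b i) x‖ₑ ^ 2 = ‖x‖ₑ ^ 2 := by
  rw [← b.repr.enorm_map x, ← lp.tsum_enorm_sq]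
  simp only [b.repr_apply_apply]

section HilbertSpaces

variable {K L ι : Type*} [NormedAddCommGroup K] [InnerProductSpace ℂ K] [CompleteSpace K]
  [NormedAddCommGroup L] [InnerProductSpace ℂ L] [CompleteSpace L] {d : ℕ}

/-- Expand `‖V* (Ω eᵢ)‖²` by Parseval's identity in `K`. If the family `c r` contributes `‖V (f r) i‖²`
for every `i`, then summing over `i` gives `∑ᵣ ‖V (f r)‖² = d`. -/
theorem tsum_enorm_sq_adjoint_single {c : Fin d → ι → K}
    (hc : ∀ ξ, ∑' (r) (p), ‖inner ℂ (c r p) ξ‖ₑ ^ 2 = ‖ξ‖ₑ ^ 2)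
    (V : K →ₗᵢ[ℂ] lp (fun _ : ℕ => L) 2) (Ω : L) {f : Fin d → K} (hf : ∀ r, ‖f r‖ = 1)
    (h : ∀ r i, ∑' p, ‖inner ℂ (V (c r p) i) Ω‖ₑ ^ 2 = ‖V (f r) i‖ₑ ^ 2) :
    ∑' i : ℕ, ‖V.toContinuousLinearMap.adjoint (lp.single 2 i Ω)‖ₑ ^ 2 = d := by
  have hterm : ∀ i : ℕ, ‖V.toContinuousLinearMap.adjoint (lp.single 2 i Ω)‖ₑ ^ 2 =
      ∑' r, ‖V (f r) i‖ₑ ^ 2 := fun i => by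
    rw [← hc]
    refine tsum_congr fun r => ?_
    rw [← h]
    refine tsum_congr fun p => ?_
    rw [ContinuousLinearMap.adjoint_inner_right, LinearIsometry.coe_toContinuousLinearMap,
      lp.inner_single_right]
  simp only [hterm]
  rw [ENNReal.tsum_comm]
  simp only [lp.tsum_enorm_sq, V.enorm_map]
  simp [enorm_sq_eq_ofReal, hf]

/-- Isometries `W r : L → K`, `r < d`, whose ranges span `K` orthogonally give an isometry of `K`
into `ℓ²(ℕ, L)` with coordinates `W r*`. -/
theorem exists_isometry_adjoint {c : Fin d → ι → K}
    (hc : ∀ ξ, ∑' (r) (p), ‖inner ℂ (c r p) ξ‖ₑ ^ 2 = ‖ξ‖ₑ ^ 2) (b : HilbertBasis ι ℂ L)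
    (W : ℕ → L →ₗᵢ[ℂ] K) (hW : ∀ (r : Fin d) p, W r (b p) = c r p) :
    ∃ V : K →ₗᵢ[ℂ] lp (fun _ : ℕ => L) 2, ∀ ξ i,
      V ξ i = if i < d then (W i).toContinuousLinearMap.adjoint ξ else 0 := by
  obtain ⟨T, hTlt, hT0⟩ : ∃ T : ℕ → K →L[ℂ] L,
      (∀ i, i < d → T i = (W i).toContinuousLinearMap.adjoint) ∧ ∀ i, ¬ i < d → T i = 0 :=
    ⟨fun i => if i < d then (W i).toContinuousLinearMap.adjoint else 0,
      fun i hi => if_pos hi, fun i hi => if_neg hi⟩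
  have hT : ∀ ξ, ∑' i, ‖T i ξ‖ₑ ^ 2 = ‖ξ‖ₑ ^ 2 := fun ξ => by
    rw [tsum_eq_sum (s := Finset.range d) fun i hi => by simp [hT0 i (by simpa using hi)],
      Finset.sum_range, ← hc, tsum_fintype]
    refine Finset.sum_congr rfl fun r _ => ?_
    rw [hTlt r r.2, ← b.tsum_enorm_sq_inner]
    refine tsum_congr fun p => ?_
    rw [ContinuousLinearMap.adjoint_inner_right, LinearIsometry.coe_toContinuousLinearMap, hW]
  let V : K →ₗ[ℂ] lp (fun _ : ℕ => L) 2 :=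
    { toFun := fun ξ => ⟨fun i => T i ξ, memℓp_two_iff_summable.mpr <|
        summable_of_ne_finset_zero (s := Finset.range d) fun i hi => by
          simp [hT0 i (by simpa using hi)]⟩
      map_add' := fun x y => by ext i; exact map_add (T i) x y
      map_smul' := fun c x => by ext i; exact map_smul (T i) c x }
  have hV : ∀ ξ, ‖V ξ‖ₑ ^ 2 = ‖ξ‖ₑ ^ 2 := fun ξ => (lp.tsum_enorm_sq (V ξ)).symm.trans (hT ξ)
  refine ⟨⟨V, fun ξ => ?_⟩, fun ξ i => ?_⟩
  · have := hV ξ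
    rw [enorm_sq_eq_ofReal, enorm_sq_eq_ofReal, ENNReal.ofReal_eq_ofReal_iff (by positivity)
      (by positivity)] at this
    exact (sq_eq_sq₀ (norm_nonneg _) (norm_nonneg _)).mp this
  · change T i ξ = _
    split_ifs with hi
    · rw [hTlt i hi]
    · rw [hT0 i hi]; rfl

end HilbertSpaces

theorem IsFaithfulNormalTracialState.restrict {N M : VonNeumannAlgebra H} {τ : M →ₚ[ℂ] ℂ}
    (hτ : IsFaithfulNormalTracialState τ) (h : N ≤ M) :
    IsFaithfulNormalTracialState (restrictFunctional h τ) where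
  map_one := hτ.map_one
  tracial x y := hτ.tracial (vonNeumannInclusion h x) (vonNeumannInclusion h y)
  faithful x hx := by
    have := hτ.faithful (vonNeumannInclusion h x) hx
    exact Subtype.ext (congrArg (fun y : M => (y : H →L[ℂ] H)) this)
  normal := by
    obtain ⟨ξ, hs, hξ⟩ := hτ.normal
    exact ⟨ξ, hs, fun x => hξ (vonNeumannInclusion h x)⟩

/-- Division with remainder by `d` in the second exponent. -/
def monomialEquiv (d : ℕ) [NeZero d] : Fin d × (ℤ × ℤ) ≃ ℤ × ℤ :=
  (Equiv.prodAssoc _ _ _).symm.trans <| (Equiv.prodCongr (Equiv.prodComm _ _) (Equiv.refl ℤ)).trans <|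
    (Equiv.prodAssoc _ _ _).trans <| Equiv.prodCongr (Equiv.refl ℤ)
      ((Equiv.prodComm _ _).trans (Int.divModEquiv d).symm)

theorem monomialEquiv_apply (d : ℕ) [NeZero d] (r : Fin d) (a q : ℤ) :
    monomialEquiv d (r, (a, q)) = (a, d * q + r) := by
  simp [monomialEquiv, Int.divModEquiv, mul_comm]

theorem tsum_tsum_monomialEquiv {K : Type*} [NormedAddCommGroup K] [InnerProductSpace ℂ K]
    {d : ℕ} [NeZero d] (b : HilbertBasis (ℤ × ℤ) ℂ K) (ξ : K) :
    ∑' (r) (p), ‖inner ℂ (b (monomialEquiv d (r, p))) ξ‖ₑ ^ 2 = ‖ξ‖ₑ ^ 2 := by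
  rw [← b.tsum_enorm_sq_inner, ← (monomialEquiv d).tsum_eq, ENNReal.tsum_prod']

theorem monomial_monomialEquiv (u v : unitary (H →L[ℂ] H)) (d : ℕ) [NeZero d] (r : Fin d)
    (p : ℤ × ℤ) : (monomial u v (monomialEquiv d (r, p)) : H →L[ℂ] H) =
      monomial u (v ^ d) p * ((v ^ (r : ℕ) : unitary (H →L[ℂ] H))) := by
  obtain ⟨a, q⟩ := p
  rw [monomialEquiv_apply, coe_monomial, coe_monomial, coe_unitary_zpow_add, mul_assoc, zpow_mul,
    zpow_natCast, zpow_natCast]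

variable {N R : VonNeumannAlgebra H} {ζ : ℂ} {u v : unitary (H →L[ℂ] H)}

theorem star_monomialIn (h : IsRotationPair ζ u v) (hu : (u : H →L[ℂ] H) ∈ N)
    (hv : (v : H →L[ℂ] H) ∈ N) (p : ℤ × ℤ) :
    star (monomialIn hu hv p) = ζ ^ (p.2 * p.1) • monomialIn hu hv (-p) := by
  obtain ⟨a, b⟩ := p
  refine Subtype.ext ?_
  change star (monomial u v (a, b) : H →L[ℂ] H) =
    ζ ^ (b * a) • (monomial u v (-a, -b) : H →L[ℂ] H)
  rw [coe_monomial, coe_monomial, star_mul, star_unitary_zpow, star_unitary_zpow, h.zpow_mul_zpow,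
    neg_mul_neg]

theorem enorm_inner_star_monomialIn {σ : N →ₚ[ℂ] ℂ} (h : IsRotationPair ζ u v)
    (hu : (u : H →L[ℂ] H) ∈ N) (hv : (v : H →L[ℂ] H) ∈ N) (p : ℤ × ℤ) (x : σ.GNS) :
    ‖inner ℂ x (gnsEmbedding σ (star (monomialIn hu hv p)))‖ₑ =
      ‖inner ℂ (gnsEmbedding σ (monomialIn hu hv (-p))) x‖ₑ := by
  rw [star_monomialIn h, map_smul, inner_smul_right, enorm_mul, ← inner_conj_symm]
  have h1 : ‖ζ ^ (p.2 * p.1)‖ₑ = 1 := by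
    rw [← ofReal_norm, norm_zpow, h.norm_eq, one_zpow, ENNReal.ofReal_one]
  rw [h1, one_mul, ← ofReal_norm, ← ofReal_norm, RCLike.norm_conj]

variable {τ : R →ₚ[ℂ] ℂ} {σ : N →ₚ[ℂ] ℂ} (d : ℕ) [NeZero d]

set_option maxHeartbeats 600000 in
/-- Any isometry of `N`-modules computes the dimension as `d`: by Parseval's identity for the
monomial bases of `L²(R)` and `L²(N)`, the sum equals `∑ᵣ ‖V v̂ʳ‖²` over `0 ≤ r < d`. -/
theorem tsum_adjoint_single (hτ : IsFaithfulNormalTracialState τ)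
    (hσ : IsFaithfulNormalTracialState σ) (h : IsRotationPair ζ u v) {w : unitary (H →L[ℂ] H)}
    (hw : w = v ^ d) (hNR : N ≤ R)
    (hR : R = vonNeumannGenerated {(u : H →L[ℂ] H), (v : H →L[ℂ] H)})
    (hN : N = vonNeumannGenerated {(u : H →L[ℂ] H), (w : H →L[ℂ] H)})
    {π : N →⋆ₐ[ℂ] (τ.GNS →L[ℂ] τ.GNS)} (hπ : ∀ (x : N) (y : R),
      π x (gnsEmbedding τ y) = gnsEmbedding τ (vonNeumannInclusion hNR x * y))
    (V : τ.GNS →ₗᵢ[ℂ] lp (fun _ : ℕ => σ.GNS) 2)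
    (hV : ∀ (x : N) (ξ : τ.GNS) (i : ℕ), V (π x ξ) i = σ.gnsStarAlgHom x (V ξ i)) :
    ∑' i : ℕ, ‖V.toContinuousLinearMap.adjoint (lp.single 2 i (gnsVector σ))‖ₑ ^ 2 = d := by
  have hu : (u : H →L[ℂ] H) ∈ R := hR ▸ subset_vonNeumannGenerated _ (Or.inl rfl)
  have hv : (v : H →L[ℂ] H) ∈ R := hR ▸ subset_vonNeumannGenerated _ (Or.inr rfl)
  have hu' : (u : H →L[ℂ] H) ∈ N := hN ▸ subset_vonNeumannGenerated _ (Or.inl rfl)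
  have hv' : (w : H →L[ℂ] H) ∈ N :=
    hN ▸ subset_vonNeumannGenerated _ (Or.inr rfl)
  have h' : IsRotationPair (ζ ^ d) u w := hw ▸ h.pow_right (NeZero.pos d)
  obtain ⟨b, hb⟩ := hτ.exists_monomial_hilbertBasis h hu hv hR
  obtain ⟨b', hb'⟩ := hσ.exists_monomial_hilbertBasis h' hu' hv' hN
  have hbf : ∀ (r : Fin d) (p : ℤ × ℤ), b (monomialEquiv d (r, p)) =
      π (monomialIn hu' hv' p) (b (0, (r : ℕ))) := by
    intro r p
    rw [hb, hb, hπ]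
    refine congrArg _ (Subtype.ext ?_)
    change (monomial u v (monomialEquiv d (r, p)) : H →L[ℂ] H) =
      monomial u w p * monomial u v (0, (r : ℕ))
    rw [hw, monomial_monomialEquiv, coe_monomial u v, zpow_zero, zpow_natCast]
    exact congrArg _ (one_mul _).symm
  refine tsum_enorm_sq_adjoint_single (c := fun r p => b (monomialEquiv d (r, p)))
    (tsum_tsum_monomialEquiv b) V _ (f := fun r => b (0, (r : ℕ))) (fun r => b.orthonormal.1 _)
    fun r i => ?_
  rw [← b'.tsum_enorm_sq_inner, ← (Equiv.neg (ℤ × ℤ)).tsum_eq]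
  refine tsum_congr fun p => ?_
  rw [hbf, hV, ← ContinuousLinearMap.adjoint_inner_right,
      ← ContinuousLinearMap.star_eq_adjoint, ← map_star, gnsVector_eq, gnsStarAlgHom_gnsEmbedding,
      mul_one, enorm_inner_star_monomialIn h', hb', Equiv.neg_apply, neg_neg]

/-- Right multiplication by `vʳ` is an isometry of `N`-modules from `L²(N)` to `L²(R)`. -/
theorem exists_mulRight_isometry (hτ : IsFaithfulNormalTracialState τ) (hNR : N ≤ R)
    (hσ : ∀ x : N, σ x = τ (vonNeumannInclusion hNR x))
    {π : N →⋆ₐ[ℂ] (τ.GNS →L[ℂ] τ.GNS)} (hπ : ∀ (x : N) (y : R),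
      π x (gnsEmbedding τ y) = gnsEmbedding τ (vonNeumannInclusion hNR x * y))
    {w : R} (hw : w * star w = 1) : ∃ W : σ.GNS →ₗᵢ[ℂ] τ.GNS,
      (∀ x : N, W (gnsEmbedding σ x) = gnsEmbedding τ (vonNeumannInclusion hNR x * w)) ∧
      ∀ (x : N) (ξ : σ.GNS), W (σ.gnsStarAlgHom x ξ) = π x (W ξ) := by
  obtain ⟨W, hW⟩ := exists_gns_isometry (σ := σ) (τ := τ)
    (LinearMap.mulRight ℂ w ∘ₗ (vonNeumannInclusion hNR).toAlgHom.toLinearMap) fun x => by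
      rw [← sq_eq_sq₀ (norm_nonneg _) (norm_nonneg _), ← Complex.ofReal_inj, norm_sq_gnsEmbedding,
        norm_sq_gnsEmbedding, hσ, map_mul (vonNeumannInclusion hNR), map_star (vonNeumannInclusion hNR)]
      change τ (star (vonNeumannInclusion hNR x * w) * (vonNeumannInclusion hNR x * w)) = _
      rw [hτ.tracial, hτ.tracial (star (vonNeumannInclusion hNR x)), star_mul, mul_assoc,
        ← mul_assoc _ _ (star (vonNeumannInclusion hNR x)), hw, one_mul]
  refine ⟨W, hW, fun x => congrFun ((denseRange_gnsEmbedding σ).equalizer ?_ ?_ ?_)⟩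
  · exact W.continuous.comp (σ.gnsStarAlgHom x).continuous
  · exact (π x).continuous.comp W.continuous
  · funext y
    have h1 := hW y
    have h2 := hW (x * y)
    change W (σ.gnsStarAlgHom x (gnsEmbedding σ y)) = π x (W (gnsEmbedding σ y))
    rw [gnsStarAlgHom_gnsEmbedding, h1, h2, hπ]
    refine congrArg _ ?_
    change vonNeumannInclusion hNR (x * y) * w =
      vonNeumannInclusion hNR x * (vonNeumannInclusion hNR y * w)
    rw [map_mul, mul_assoc]

set_option maxHeartbeats 600000 in
/-- The decomposition `L²(R) = ⨁ᵣ L²(N) vʳ`, `0 ≤ r < d`, gives an isometry of `N`-modules from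
`L²(R)` to `ℓ²(ℕ) ⊗ L²(N)`. -/
theorem exists_module_isometry (hτ : IsFaithfulNormalTracialState τ)
    (hσ : IsFaithfulNormalTracialState σ) (h : IsRotationPair ζ u v) {w : unitary (H →L[ℂ] H)}
    (hw : w = v ^ d) (hNR : N ≤ R)
    (hστ : ∀ x : N, σ x = τ (vonNeumannInclusion hNR x))
    (hR : R = vonNeumannGenerated {(u : H →L[ℂ] H), (v : H →L[ℂ] H)})
    (hN : N = vonNeumannGenerated {(u : H →L[ℂ] H), (w : H →L[ℂ] H)})
    {π : N →⋆ₐ[ℂ] (τ.GNS →L[ℂ] τ.GNS)} (hπ : ∀ (x : N) (y : R),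
      π x (gnsEmbedding τ y) = gnsEmbedding τ (vonNeumannInclusion hNR x * y)) :
    ∃ V : τ.GNS →ₗᵢ[ℂ] lp (fun _ : ℕ => σ.GNS) 2,
      ∀ (x : N) (ξ : τ.GNS) (i : ℕ), V (π x ξ) i = σ.gnsStarAlgHom x (V ξ i) := by
  have hu : (u : H →L[ℂ] H) ∈ R := hR ▸ subset_vonNeumannGenerated _ (Or.inl rfl)
  have hv : (v : H →L[ℂ] H) ∈ R := hR ▸ subset_vonNeumannGenerated _ (Or.inr rfl)
  have hu' : (u : H →L[ℂ] H) ∈ N := hN ▸ subset_vonNeumannGenerated _ (Or.inl rfl)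
  have hv' : (w : H →L[ℂ] H) ∈ N :=
    hN ▸ subset_vonNeumannGenerated _ (Or.inr rfl)
  have h' : IsRotationPair (ζ ^ d) u w := hw ▸ h.pow_right (NeZero.pos d)
  obtain ⟨b, hb⟩ := hτ.exists_monomial_hilbertBasis h hu hv hR
  obtain ⟨b', hb'⟩ := hσ.exists_monomial_hilbertBasis h' hu' hv' hN
  have hvr : ∀ r : ℕ, (⟨v, hv⟩ : R) ^ r * star ((⟨v, hv⟩ : R) ^ r) = 1 := fun r => by
    have : (⟨v, hv⟩ : R) ∈ unitary R := ⟨Subtype.ext v.2.1, Subtype.ext v.2.2⟩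
    exact (pow_mem this r).2
  choose W hW hWπ using fun r : ℕ => exists_mulRight_isometry hτ hNR hστ hπ (hvr r)
  have hWb : ∀ (r : Fin d) (p : ℤ × ℤ), W r (b' p) = b (monomialEquiv d (r, p)) := fun r p => by
    rw [hb, hb', hW]
    refine congrArg _ (Subtype.ext ?_)
    change (monomial u w p : H →L[ℂ] H) * (v : H →L[ℂ] H) ^ (r : ℕ) =
      (monomial u v (monomialEquiv d (r, p)))
    rw [hw, monomial_monomialEquiv]
    rfl
  obtain ⟨V, hV⟩ := exists_isometry_adjoint (tsum_tsum_monomialEquiv b) b' W hWb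
  refine ⟨V, fun x ξ i => ?_⟩
  rw [hV, hV]
  split_ifs with hi
  · refine ext_inner_right ℂ fun η => ?_
    rw [ContinuousLinearMap.adjoint_inner_left, ← ContinuousLinearMap.adjoint_inner_right (π x),
      ← ContinuousLinearMap.adjoint_inner_right (σ.gnsStarAlgHom x),
      ← ContinuousLinearMap.star_eq_adjoint, ← ContinuousLinearMap.star_eq_adjoint,
      ← map_star, ← map_star, ContinuousLinearMap.adjoint_inner_left,
      LinearIsometry.coe_toContinuousLinearMap, hWπ]
  · rw [map_zero]

theorem jonesIndex_eq (hτ : IsFaithfulNormalTracialState τ) (h : IsRotationPair ζ u v)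
    (hNR : N ≤ R)
    (hR : R = vonNeumannGenerated {(u : H →L[ℂ] H), (v : H →L[ℂ] H)})
    (hN : N = vonNeumannGenerated {(u : H →L[ℂ] H), (v : H →L[ℂ] H) ^ d}) :
    jonesIndex hNR τ = d := by
  rw [← SubmonoidClass.coe_pow] at hN
  have hσ := hτ.restrict hNR
  have hπ : ∀ (x : N) (y : R), (τ.gnsStarAlgHom.comp (vonNeumannInclusion hNR)) x
      (gnsEmbedding τ y) = gnsEmbedding τ (vonNeumannInclusion hNR x * y) := fun x y =>
    gnsStarAlgHom_gnsEmbedding τ _ _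
  obtain ⟨V, hV⟩ := exists_module_isometry d hτ hσ h rfl hNR (fun _ => rfl) hR hN hπ
  refine le_antisymm
    ((iInf₂_le V hV).trans_eq (tsum_adjoint_single d hτ hσ h rfl hNR hR hN hπ V hV)) ?_
  exact le_iInf₂ fun V hV => (tsum_adjoint_single d hτ hσ h rfl hNR hR hN hπ V hV).ge

end Index

/-! ### Periods of functions and relative commutants -/

section Periods

/-- Rotating by `ω` multiplies the `k`-th Fourier coefficient by `ωᵏ`, and an integrable function is
determined by its Fourier coefficients. -/
theorem isCirclePeriod_iff {f : Circle → ℂ} (hf : Integrable f circleMeasure) (ω : Circle) :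
    IsCirclePeriod f ω ↔ ∀ k : ℤ, circleFourierCoeff f k ≠ 0 → ω ^ k = 1 := by
  have hfω : Integrable (fun z => f (ω * z)) circleMeasure := hf.comp_mul_left ω
  have hrot : ∀ k : ℤ, ∫ z : Circle, f (ω * z) * (z : ℂ) ^ (-k) ∂circleMeasure =
      (ω : ℂ) ^ k * circleFourierCoeff f k := fun k => by
    have h := integral_mul_left_eq_self (μ := circleMeasure)
      (fun z : Circle => (ω : ℂ) ^ k * (f z * (z : ℂ) ^ (-k))) ω
    rw [circleFourierCoeff, ← integral_const_mul, ← h]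
    refine integral_congr_ae (Filter.Eventually.of_forall fun z => ?_)
    have hω : (ω : ℂ) ^ k ≠ 0 := zpow_ne_zero _ (Circle.coe_ne_zero ω)
    simp only [Circle.coe_mul, mul_zpow, zpow_neg]
    field_simp
  have hdiff : ∀ k : ℤ, ∫ z : Circle, (f (ω * z) - f z) * (z : ℂ) ^ (-k) ∂circleMeasure =
      ((ω : ℂ) ^ k - 1) * circleFourierCoeff f k := fun k => by
    simp only [sub_mul, one_mul]
    rw [integral_sub (hfω.mul_circle_zpow _) (hf.mul_circle_zpow _), hrot]
    rfl
  constructor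
  · intro hper k hk
    have h0 : ∫ z : Circle, (f (ω * z) - f z) * (z : ℂ) ^ (-k) ∂circleMeasure = 0 := by
      refine integral_eq_zero_of_ae ?_
      filter_upwards [hper] with z hz
      simp [hz]
    rw [hdiff] at h0
    have := sub_eq_zero.mp ((mul_eq_zero.mp h0).resolve_right hk)
    exact Circle.ext (by simpa using this)
  · intro h
    have h0 := ae_eq_zero_of_integral_zpow_eq_zero (hfω.sub hf) fun k => by
      have := hdiff (-k)
      rw [neg_neg] at this
      refine this.trans ?_
      by_cases hk : circleFourierCoeff f (-k) = 0
      · rw [hk, mul_zero]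
      · have := congrArg (fun z : Circle => (z : ℂ)) (h _ hk)
        simp only [Circle.coe_zpow, Circle.coe_one] at this
        rw [this, sub_self, zero_mul]
    filter_upwards [h0] with z hz
    exact sub_eq_zero.mp hz

theorem circle_exp_zpow_eq_one_iff (t : ℝ) (k : ℤ) :
    Circle.exp (2 * Real.pi * t) ^ k = 1 ↔ ∃ m : ℤ, k * t = m := by
  rw [← Circle.exp_intCast_mul, Circle.exp_eq_one]
  refine exists_congr fun m => ?_
  have := Real.pi_pos.ne'
  constructor
  · intro h
    field_simp at h
    linarith
  · intro h
    rw [← h]; ring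

theorem dvd_of_mem_of_closure_eq {S : Set ℤ} {d : ℕ}
    (hd : AddSubgroup.closure S = AddSubgroup.zmultiples (d : ℤ)) {k : ℤ} (hk : k ∈ S) :
    (d : ℤ) ∣ k := by
  have := AddSubgroup.subset_closure hk
  rw [hd] at this
  exact Int.mem_zmultiples_iff.mp this

theorem forall_zpow_eq_one_iff {S : Set ℤ} {d : ℕ}
    (hd : AddSubgroup.closure S = AddSubgroup.zmultiples (d : ℤ)) {G : Type*} [Group G] (ω : G) :
    (∀ k ∈ S, ω ^ k = 1) ↔ ω ^ (d : ℤ) = 1 := by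
  constructor
  · intro h
    have hle : AddSubgroup.closure S ≤
        (MonoidHom.ker (zpowersHom G ω)).toAddSubgroup' := (AddSubgroup.closure_le _).mpr h
    exact hle (hd ▸ AddSubgroup.mem_zmultiples _)
  · intro h k hk
    obtain ⟨m, rfl⟩ := dvd_of_mem_of_closure_eq hd hk
    rw [zpow_mul, h, one_zpow]

theorem isGcdOfSet_iff {S : Set ℤ} {d : ℕ}
    (hd : AddSubgroup.closure S = AddSubgroup.zmultiples (d : ℤ)) (n : ℕ) :
    IsGcdOfSet S n ↔ n = d := by
  have hdvd : ∀ e : ℤ, (∀ k ∈ S, e ∣ k) → e ∣ d := fun e he => by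
    have hle : AddSubgroup.closure S ≤ AddSubgroup.zmultiples e :=
      (AddSubgroup.closure_le _).mpr fun k hk => Int.mem_zmultiples_iff.mpr (he k hk)
    exact Int.mem_zmultiples_iff.mp (hle (hd ▸ AddSubgroup.mem_zmultiples _))
  constructor
  · rintro ⟨h1, h2⟩
    exact Nat.dvd_antisymm (Int.natCast_dvd_natCast.mp (hdvd n h1))
      (Int.natCast_dvd_natCast.mp (h2 d fun k hk => dvd_of_mem_of_closure_eq hd hk))
  · rintro rfl
    exact ⟨fun k hk => dvd_of_mem_of_closure_eq hd hk, hdvd⟩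

/-- The periods of `f` are the `d`-th roots of unity, `d` the greatest common divisor of the
frequencies of `f`. -/
theorem hasMinimalCirclePeriod_iff {f : Circle → ℂ} (hf : Integrable f circleMeasure) {d : ℕ}
    (hd0 : 0 < d) (hd : AddSubgroup.closure {k : ℤ | circleFourierCoeff f k ≠ 0} =
      AddSubgroup.zmultiples (d : ℤ)) {n : ℕ} (hn : 0 < n) :
    HasMinimalCirclePeriod f n ↔ n = d := by
  have hper : ∀ t : ℝ, IsCirclePeriod f (Circle.exp (2 * Real.pi * t)) ↔ ∃ m : ℤ, d * t = m :=
    fun t => by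
      rw [isCirclePeriod_iff hf]
      refine (forall_zpow_eq_one_iff hd _).trans ?_
      rw [circle_exp_zpow_eq_one_iff]
      simp
  have hn' : (0 : ℝ) < n := by exact_mod_cast hn
  have hd' : (0 : ℝ) < d := by exact_mod_cast hd0
  rw [HasMinimalCirclePeriod, div_eq_mul_one_div, hper]
  constructor
  · rintro ⟨⟨m, hm⟩, hmin⟩
    have hm0 : (0 : ℝ) < m := by rw [← hm]; positivity
    have hm1 : (1 : ℝ) ≤ m := by exact_mod_cast (by exact_mod_cast hm0 : (0 : ℤ) < m)
    have hle : (n : ℝ) ≤ d := by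
      rw [← hm, mul_one_div, le_div_iff₀ hn', one_mul] at hm1
      exact hm1
    rcases hle.lt_or_eq with hlt | heq
    · refine absurd ((hper (1 / d)).mpr ⟨1, ?_⟩) (hmin (1 / d) (by positivity)
        (one_div_lt_one_div_of_lt hn' hlt))
      rw [mul_one_div_cancel hd'.ne', Int.cast_one]
    · exact_mod_cast heq
  · rintro rfl
    refine ⟨⟨1, by rw [mul_one_div_cancel hn'.ne', Int.cast_one]⟩, fun t ht0 ht1 hp => ?_⟩
    obtain ⟨m, hm⟩ := (hper t).mp hp
    have h1 : (0 : ℝ) < m := by rw [← hm]; positivity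
    have h2 : (m : ℝ) < 1 := by
      rw [← hm, mul_comm]
      exact (lt_div_iff₀ hn').mp ht1
    have h1' : 0 < m := by exact_mod_cast h1
    have h2' : m < 1 := by exact_mod_cast h2
    omega

end Periods

section RelativeCommutant

variable {H : Type*} [NormedAddCommGroup H] [InnerProductSpace ℂ H] [CompleteSpace H]
  {M : VonNeumannAlgebra H} {τ : M →ₚ[ℂ] ℂ} {ζ : ℂ} {u v : unitary (H →L[ℂ] H)}

theorem IsRotationPair.of_irrational {θ : ℝ} (hθ : Irrational θ)
    (huv : (v : H →L[ℂ] H) * u =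
      Complex.exp (2 * Real.pi * Complex.I * θ) • ((u : H →L[ℂ] H) * v)) :
    IsRotationPair (Complex.exp (2 * Real.pi * Complex.I * θ)) u v where
  norm_eq := by
    rw [show (2 * Real.pi * Complex.I * θ : ℂ) = ((2 * Real.pi * θ : ℝ) : ℂ) * Complex.I by
      push_cast; ring]
    exact Complex.norm_exp_ofReal_mul_I _
  zpow_ne k hk h := by
    rw [← Complex.exp_int_mul, Complex.exp_eq_one_iff] at h
    obtain ⟨n, hn⟩ := h
    have h1 : ((k * θ : ℝ) : ℂ) = ((n : ℝ) : ℂ) := by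
      have h2 := Complex.two_pi_I_ne_zero
      apply mul_right_cancel₀ h2
      push_cast
      linear_combination hn
    have h3 : (k : ℝ) * θ = n := by exact_mod_cast h1
    exact (hθ.intCast_mul hk).ne_int n h3
  comm := huv

namespace IsFaithfulNormalTracialState

/-- An element commuting with a unitary `w` is orthogonal to the eigenvectors of conjugation by `w`
for eigenvalues other than `1`. -/
theorem inner_eq_zero_of_commute (hτ : IsFaithfulNormalTracialState τ) {c : ℂ} (hc : c ≠ 1)
    {w x e : M} (hw : w ∈ unitary M) (hx : w * x = x * w) (he : w * e * star w = c • e) :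
    inner ℂ (gnsEmbedding τ e) (gnsEmbedding τ x) = 0 := by
  have h1 : w * (star e * x) * star w = (starRingEnd ℂ) c • (star e * x) := by
    calc w * (star e * x) * star w = w * star e * (x * star w) := by simp only [mul_assoc]
      _ = w * star e * (star w * w * x * star w) := by rw [hw.1, one_mul]
      _ = star (w * e * star w) * (x * (w * star w)) := by
        rw [mul_assoc (star w), hx]
        simp only [star_mul, star_star, mul_assoc]
      _ = (starRingEnd ℂ) c • (star e * x) := by
        rw [he, hw.2, mul_one, star_smul, smul_mul_assoc]; rfl
  have h2 := hτ.map_conj hw.1 (star e * x)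
  rw [h1, map_smul, smul_eq_mul] at h2
  rw [inner_gnsEmbedding]
  by_contra h0
  have h3 := mul_right_cancel₀ h0 (h2.trans (one_mul _).symm)
  exact hc (by simpa using congrArg (starRingEnd ℂ) h3)

/-- An element of `W*(u, v)` whose Fourier expansion has only the constant term is a scalar. -/
theorem exists_eq_smul_one (hτ : IsFaithfulNormalTracialState τ)
    (h : IsRotationPair ζ u v) (hu : (u : H →L[ℂ] H) ∈ M) (hv : (v : H →L[ℂ] H) ∈ M)
    (hM : M = vonNeumannGenerated {(u : H →L[ℂ] H), (v : H →L[ℂ] H)}) {x : M}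
    (hx : ∀ p ≠ 0, inner ℂ (gnsEmbedding τ (monomialIn hu hv p)) (gnsEmbedding τ x) = 0) :
    ∃ c : ℂ, (x : H →L[ℂ] H) = c • 1 := by
  obtain ⟨b, hb⟩ := hτ.exists_monomial_hilbertBasis h hu hv hM
  refine ⟨inner ℂ (b 0) (gnsEmbedding τ x), ?_⟩
  have h1 : gnsEmbedding τ x = gnsEmbedding τ (inner ℂ (b 0) (gnsEmbedding τ x) • 1) := by
    rw [map_smul, show (1 : M) = monomialIn hu hv 0 from Subtype.ext (mul_one _).symm, ← hb 0]
    exact b.eq_smul_of_inner_eq_zero fun q hq => by rw [hb, hx q hq]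
  exact congrArg (fun y : M => (y : H →L[ℂ] H)) (hτ.gnsEmbedding_injective h1)

end IsFaithfulNormalTracialState

theorem IsRotationPair.conj_zpow_right (h : IsRotationPair ζ u v) (k : ℤ) (p : ℤ × ℤ) :
    ((v ^ k : unitary (H →L[ℂ] H)) : H →L[ℂ] H) * monomial u v p *
      star ((v ^ k : unitary (H →L[ℂ] H)) : H →L[ℂ] H) =
        ζ ^ (k * p.1) • (monomial u v p : H →L[ℂ] H) := by
  obtain ⟨a, b⟩ := p
  rw [star_unitary_zpow, coe_monomial, ← mul_assoc, h.zpow_mul_zpow, smul_mul_assoc,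
    smul_mul_assoc, mul_assoc, mul_assoc, ← coe_unitary_zpow_add, ← coe_unitary_zpow_add]
  congr 3
  ring_nf

/-- `W*(u, vᵈ)` has trivial relative commutant in `W*(u, v)`: by the action of conjugation by `u`
and `vᵈ`, the Fourier expansion of an element of the relative commutant is a scalar. -/
theorem isIrreducibleIn_of_mem (hτ : IsFaithfulNormalTracialState τ)
    (h : IsRotationPair ζ u v) (hM : M = vonNeumannGenerated {(u : H →L[ℂ] H), (v : H →L[ℂ] H)})
    {N : VonNeumannAlgebra H} (huN : (u : H →L[ℂ] H) ∈ N) {d : ℤ} (hd : d ≠ 0)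
    (hvN : ((v ^ d : unitary (H →L[ℂ] H)) : H →L[ℂ] H) ∈ N) : IsIrreducibleIn N M := by
  have hu : (u : H →L[ℂ] H) ∈ M := hM ▸ subset_vonNeumannGenerated _ (Or.inl rfl)
  have hv : (v : H →L[ℂ] H) ∈ M := hM ▸ subset_vonNeumannGenerated _ (Or.inr rfl)
  intro x hxM hx
  refine hτ.exists_eq_smul_one h hu hv hM (x := ⟨x, hxM⟩) fun p hp => ?_
  by_cases hb : p.2 = 0
  · have ha : p.1 ≠ 0 := fun ha => hp (Prod.ext ha hb)
    exact hτ.inner_eq_zero_of_commute (h.zpow_ne _ (mul_ne_zero hd ha))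
      (w := ⟨_, VonNeumannAlgebra.zpow_mem hv d⟩) ⟨Subtype.ext (v ^ d).2.1, Subtype.ext (v ^ d).2.2⟩
      (Subtype.ext (hx _ hvN).symm) (Subtype.ext (h.conj_zpow_right d p))
  · exact hτ.inner_eq_zero_of_commute (h.zpow_ne _ (neg_ne_zero.mpr hb))
      (w := ⟨_, hu⟩) ⟨Subtype.ext u.2.1, Subtype.ext u.2.2⟩
      (Subtype.ext (hx _ huN).symm) (Subtype.ext (h.conj_left p))

/-- The center of an irreducible subalgebra lies in its relative commutant, so it is trivial; the
monomials make the subalgebra infinite-dimensional. -/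
theorem isTypeII1Factor_of_isIrreducibleIn (hτ : IsFaithfulNormalTracialState τ)
    {N : VonNeumannAlgebra H} (hNM : N ≤ M) (hirr : IsIrreducibleIn N M)
    (h : IsRotationPair ζ u v) (hu : (u : H →L[ℂ] H) ∈ N) (hv : (v : H →L[ℂ] H) ∈ N) :
    IsTypeII1Factor N where
  factor x hx hxN := hirr x (hNM hx) hxN
  infinite := fun hfin => by
    have hσ := hτ.restrict hNM
    have hli := (hσ.orthonormal_monomialIn h hu hv).linearIndependent.of_comp (gnsEmbedding _)
    have := hli.finite_of_isNoetherian
    exact not_finite (ℤ × ℤ)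
  exists_trace := ⟨_, hτ.restrict hNM⟩

end RelativeCommutant

/-! ### The algebra generated by `u` and `f(v)` -/

section Subfactor

variable {H : Type*} [NormedAddCommGroup H] [InnerProductSpace ℂ H] [CompleteSpace H]
  {R : VonNeumannAlgebra H} {τ : R →ₚ[ℂ] ℂ} {ζ : ℂ} {u v : unitary (H →L[ℂ] H)}
  {f : Circle → ℂ} {T : H →L[ℂ] H}

theorem IsFunctionOfUnitary.commute (hT : IsFunctionOfUnitary v f T) :
    (v : H →L[ℂ] H) * T = T * v := hT.commute_unitary (Commute.refl v)

/-- The Fourier expansion of `f(v)` is `∑ₖ αₖ vᵏ`. -/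
theorem inner_monomialIn_function (hτ : IsFaithfulNormalTracialState τ)
    (h : IsRotationPair ζ u v) (hu : (u : H →L[ℂ] H) ∈ R) (hv : (v : H →L[ℂ] H) ∈ R)
    (hf : Integrable f circleMeasure) (hT : IsFunctionOfUnitary v f T) (hTR : T ∈ R)
    (p : ℤ × ℤ) :
    inner ℂ (gnsEmbedding τ (monomialIn hu hv p)) (gnsEmbedding τ ⟨T, hTR⟩) =
      if p.1 = 0 then circleFourierCoeff f p.2 else 0 := by
  split_ifs with hp
  · obtain ⟨a, k⟩ := p
    obtain rfl : a = 0 := hp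
    have hmono : ∀ k : ℤ, (monomial u v (0, k) : H →L[ℂ] H) =
        ((v ^ k : unitary (H →L[ℂ] H)) : H →L[ℂ] H) := fun k => one_mul _
    rw [inner_gnsEmbedding]
    refine hτ.trace_zpow_mul_function (fun j => ⟨monomialIn hu hv (0, j), hmono j, ?_⟩) hf hT k _
      (congrArg (fun y : H →L[ℂ] H => star y * T) (hmono k))
    rw [hτ.trace_monomialIn h]
    exact if_congr (by simp) rfl rfl
  · exact hτ.inner_eq_zero_of_commute (h.zpow_ne _ hp) (w := ⟨_, hv⟩)
      ⟨Subtype.ext v.2.1, Subtype.ext v.2.2⟩ (Subtype.ext hT.commute)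
      (Subtype.ext (h.conj_right p))

/-- `W*(u, f(v))` is normalized by `u` and by `v`. -/
theorem conj_mem_of_isFunctionOfUnitary (h : IsRotationPair ζ u v)
    (hT : IsFunctionOfUnitary v f T) :
    ∀ w ∈ ({(u : H →L[ℂ] H), (v : H →L[ℂ] H)} : Set (H →L[ℂ] H)),
      ∀ y ∈ vonNeumannGenerated {(u : H →L[ℂ] H), T},
        w * y * star w ∈ vonNeumannGenerated {(u : H →L[ℂ] H), T} ∧
        star w * y * w ∈ vonNeumannGenerated {(u : H →L[ℂ] H), T} := by
  have huN : (u : H →L[ℂ] H) ∈ vonNeumannGenerated {(u : H →L[ℂ] H), T} :=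
    subset_vonNeumannGenerated _ (Or.inl rfl)
  have hTN : T ∈ vonNeumannGenerated {(u : H →L[ℂ] H), T} :=
    subset_vonNeumannGenerated _ (Or.inr rfl)
  have hv1 : star (v : H →L[ℂ] H) * v = 1 := v.2.1
  have hv2 : (v : H →L[ℂ] H) * star (v : H →L[ℂ] H) = 1 := v.2.2
  have hvu : (v : H →L[ℂ] H) * u * star (v : H →L[ℂ] H) = ζ • (u : H →L[ℂ] H) := by
    rw [h.comm, smul_mul_assoc, mul_assoc, hv2, mul_one]
  have hvu' : star (v : H →L[ℂ] H) * u * v = ζ⁻¹ • (u : H →L[ℂ] H) := by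
    have h1 : ζ • (star (v : H →L[ℂ] H) * u * v) = u := by
      rw [mul_assoc, ← mul_smul_comm, ← h.comm, ← mul_assoc, hv1, one_mul]
    rw [eq_inv_smul_iff₀ h.ne_zero, h1]
  rintro w (rfl | rfl) y hy
  · exact ⟨mul_mem (mul_mem huN hy) (star_mem huN), mul_mem (mul_mem (star_mem huN) hy) huN⟩
  · refine ⟨conj_mem_vonNeumannGenerated v.2 ?_ hy, ?_⟩
    · rintro s (rfl | rfl)
      · rw [hvu]; exact SMulMemClass.smul_mem _ huN
      · rw [hT.commute, mul_assoc, hv2, mul_one]; exact hTN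
    · have := conj_mem_vonNeumannGenerated (w := star (v : H →L[ℂ] H)) (Unitary.star_mem v.2)
        (S := {(u : H →L[ℂ] H), T}) (by
          rintro s (rfl | rfl)
          · rw [star_star, hvu']; exact SMulMemClass.smul_mem _ huN
          · rw [star_star, mul_assoc, ← hT.commute, ← mul_assoc, hv1, one_mul]; exact hTN) hy
      rwa [star_star] at this

/-- The powers `vᵏ` with `αₖ ≠ 0` lie in `W*(u, f(v))`, and generate the same group as `vᵈ`, where
`d` is the greatest common divisor of these `k`; conversely, the Fourier expansion of `f(v)` is a
series in `vᵈ`. -/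
theorem vonNeumannGenerated_function_eq (hτ : IsFaithfulNormalTracialState τ)
    (h : IsRotationPair ζ u v)
    (hR : R = vonNeumannGenerated {(u : H →L[ℂ] H), (v : H →L[ℂ] H)})
    (hf : Integrable f circleMeasure) (hT : IsFunctionOfUnitary v f T) (hTR : T ∈ R) {d : ℕ}
    (hd : AddSubgroup.closure {k : ℤ | circleFourierCoeff f k ≠ 0} =
      AddSubgroup.zmultiples (d : ℤ)) :
    vonNeumannGenerated {(u : H →L[ℂ] H), T} =
      vonNeumannGenerated {(u : H →L[ℂ] H), (v : H →L[ℂ] H) ^ d} := by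
  have hu : (u : H →L[ℂ] H) ∈ R := hR ▸ subset_vonNeumannGenerated _ (Or.inl rfl)
  have hv : (v : H →L[ℂ] H) ∈ R := hR ▸ subset_vonNeumannGenerated _ (Or.inr rfl)
  have hinner := inner_monomialIn_function hτ h hu hv hf hT hTR
  have hmono : ∀ k : ℤ, (monomial u v (0, k) : H →L[ℂ] H) =
      ((v ^ k : unitary (H →L[ℂ] H)) : H →L[ℂ] H) := fun k => one_mul _
  refine le_antisymm (vonNeumannGenerated_le ?_) (vonNeumannGenerated_le ?_)
  · rintro s (rfl | rfl)
    · exact subset_vonNeumannGenerated _ (Or.inl rfl)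
    · refine hτ.mem_of_monomial_mem h hu hv hR (x := ⟨s, hTR⟩) fun p hp => ?_
      rw [hinner] at hp
      obtain ⟨a, k⟩ := p
      obtain ⟨rfl, hk⟩ : a = 0 ∧ circleFourierCoeff f k ≠ 0 := by simpa using hp
      obtain ⟨q, rfl⟩ := dvd_of_mem_of_closure_eq hd hk
      rw [hmono, zpow_mul, zpow_natCast]
      refine VonNeumannAlgebra.zpow_mem ?_ q
      rw [SubmonoidClass.coe_pow]
      exact subset_vonNeumannGenerated _ (Or.inr rfl)
  · rintro s (rfl | rfl)
    · exact subset_vonNeumannGenerated _ (Or.inl rfl)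
    · let G : AddSubgroup ℤ :=
        { carrier := {k | ((v ^ k : unitary (H →L[ℂ] H)) : H →L[ℂ] H) ∈
            vonNeumannGenerated {(u : H →L[ℂ] H), T}}
          add_mem' := fun {a b} ha hb => by
            rw [Set.mem_ofPred_eq, coe_unitary_zpow_add]
            exact mul_mem (S := VonNeumannAlgebra H) ha hb
          zero_mem' := one_mem (vonNeumannGenerated {(u : H →L[ℂ] H), T})
          neg_mem' := fun {a} ha => by
            rw [Set.mem_ofPred_eq, ← star_unitary_zpow]
            exact star_mem (S := VonNeumannAlgebra H) ha }
      have hle : AddSubgroup.closure {k : ℤ | circleFourierCoeff f k ≠ 0} ≤ G := by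
        refine (AddSubgroup.closure_le _).mpr fun k hk => ?_
        have := hτ.monomial_mem_of_inner_ne_zero h hu hv hR (conj_mem_of_isFunctionOfUnitary h hT)
          (x := ⟨T, hTR⟩) (subset_vonNeumannGenerated _ (Or.inr rfl)) (p := (0, k)) (by
            rw [hinner, if_pos rfl]; exact hk)
        rw [hmono] at this
        exact this
      have hdG : (d : ℤ) ∈ G := hle (hd ▸ AddSubgroup.mem_zmultiples _)
      have h1 : ((v ^ (d : ℤ) : unitary (H →L[ℂ] H)) : H →L[ℂ] H) ∈
        vonNeumannGenerated {(u : H →L[ℂ] H), T} := hdG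
      rwa [zpow_natCast, SubmonoidClass.coe_pow] at h1

end Subfactor

end

theorem mainTheorem4 {H : Type*} [NormedAddCommGroup H] [InnerProductSpace ℂ H] [CompleteSpace H]
    (θ : ℝ) (hθ : Irrational θ)
    (u v : unitary (H →L[ℂ] H))
    (huv : (v : H →L[ℂ] H) * u = Complex.exp (2 * Real.pi * Complex.I * θ) • ((u : H →L[ℂ] H) * v))
    (R : VonNeumannAlgebra H) (hR : IsTypeII1Factor R)
    (hgen : R = vonNeumannGenerated {(u : H →L[ℂ] H), (v : H →L[ℂ] H)})
    (τ : R →ₚ[ℂ] ℂ) (hτ : IsFaithfulNormalTracialState τ)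
    (f : Circle → ℂ) (hf : MemLp f ⊤ circleMeasure)
    (hns : ¬ ∃ c : ℂ, functionOfUnitary v f = c • (1 : H →L[ℂ] H))
    (N : VonNeumannAlgebra H)
    (hN : N = vonNeumannGenerated {(u : H →L[ℂ] H), functionOfUnitary v f}) :
    ∃ hNR : N ≤ R,
      IsTypeII1Factor N ∧ IsIrreducibleIn N R ∧
      (∃ k : ℕ, 0 < k ∧ jonesIndex hNR τ = k) ∧
      ∀ n : ℕ, 0 < n →
        List.TFAE
          [HasMinimalCirclePeriod f n,
           IsGcdOfSet {k : ℤ | circleFourierCoeff f k ≠ 0} n,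
           N = vonNeumannGenerated {(u : H →L[ℂ] H), (v : H →L[ℂ] H) ^ n}] := by
  have h := IsRotationPair.of_irrational hθ huv
  have hfi : Integrable f circleMeasure := hf.integrable le_top
  -- `f(v)` exists: otherwise `functionOfUnitary v f` would be the scalar `0`.
  have hex : ∃ T, IsFunctionOfUnitary v f T := by
    by_contra hex
    exact hns ⟨0, by rw [functionOfUnitary, dif_neg hex, zero_smul]⟩
  have hT : IsFunctionOfUnitary v f (functionOfUnitary v f) := by
    rw [functionOfUnitary, dif_pos hex]
    exact hex.choose_spec
  generalize functionOfUnitary v f = T at hT hns hN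
  have hu : (u : H →L[ℂ] H) ∈ R := hgen ▸ subset_vonNeumannGenerated _ (Or.inl rfl)
  have hv : (v : H →L[ℂ] H) ∈ R := hgen ▸ subset_vonNeumannGenerated _ (Or.inr rfl)
  have hTR : T ∈ R := vonNeumannGenerated_le (by simpa using hv) hT.mem_vonNeumannGenerated
  obtain ⟨d, hd⟩ : ∃ d : ℕ, AddSubgroup.closure {k : ℤ | circleFourierCoeff f k ≠ 0} =
      AddSubgroup.zmultiples (d : ℤ) := by
    obtain ⟨a, ha⟩ := Int.subgroup_cyclic (AddSubgroup.closure {k : ℤ | circleFourierCoeff f k ≠ 0})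
    refine ⟨a.natAbs, ?_⟩
    rw [ha, Int.zmultiples_natAbs, AddSubgroup.zmultiples_eq_closure]
  have hinner := inner_monomialIn_function hτ h hu hv hfi hT hTR
  have hd0 : 0 < d := by
    by_contra hd0
    obtain rfl : d = 0 := by omega
    refine hns (hτ.exists_eq_smul_one h hu hv hgen (x := ⟨T, hTR⟩) fun p hp => ?_)
    by_contra hne
    rw [hinner] at hne
    obtain ⟨ha, hk⟩ : p.1 = 0 ∧ circleFourierCoeff f p.2 ≠ 0 := by simpa using hne
    have hdvd := dvd_of_mem_of_closure_eq hd hk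
    rw [Nat.cast_zero, zero_dvd_iff] at hdvd
    exact hp (Prod.ext ha hdvd)
  have hNd : N = vonNeumannGenerated {(u : H →L[ℂ] H), (v : H →L[ℂ] H) ^ d} :=
    hN.trans (vonNeumannGenerated_function_eq hτ h hgen hfi hT hTR hd)
  have hNR : N ≤ R := by
    rw [hN]
    refine vonNeumannGenerated_le ?_
    rintro s (rfl | rfl)
    exacts [hu, hTR]
  have huN : (u : H →L[ℂ] H) ∈ N := hN ▸ subset_vonNeumannGenerated _ (Or.inl rfl)
  have hvN : ((v ^ d : unitary (H →L[ℂ] H)) : H →L[ℂ] H) ∈ N := by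
    rw [hNd, SubmonoidClass.coe_pow]
    exact subset_vonNeumannGenerated _ (Or.inr rfl)
  have hirr : IsIrreducibleIn N R :=
    isIrreducibleIn_of_mem hτ h hgen huN (d := d) (by exact_mod_cast hd0.ne')
      (by rwa [zpow_natCast])
  have hindex : ∀ n : ℕ, 0 < n →
      N = vonNeumannGenerated {(u : H →L[ℂ] H), (v : H →L[ℂ] H) ^ n} → jonesIndex hNR τ = n :=
    fun n hn hNn => by
      have : NeZero n := ⟨hn.ne'⟩
      exact jonesIndex_eq n hτ h hNR hgen hNn
  refine ⟨hNR, isTypeII1Factor_of_isIrreducibleIn hτ hNR hirr (h.pow_right hd0) huN hvN, hirr,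
    ⟨d, hd0, hindex d hd0 hNd⟩, fun n hn => ?_⟩
  have h1 := hasMinimalCirclePeriod_iff hfi hd0 hd hn
  have h2 := isGcdOfSet_iff hd n
  -- The exponent is determined by the algebra, as it is the index.
  have h3 : N = vonNeumannGenerated {(u : H →L[ℂ] H), (v : H →L[ℂ] H) ^ n} ↔ n = d :=
    ⟨fun hNn => by exact_mod_cast (hindex n hn hNn).symm.trans (hindex d hd0 hNd),
      fun hnd => hnd ▸ hNd⟩
  tfae_have 1 ↔ 2 := h1.trans h2.symm
  tfae_have 2 ↔ 3 := h2.trans h3.symm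
  tfae_finish
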